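/- **Setting.** Let $(\Omega,\mathcal A,\mu)$ be a probability space and $T:\Omega\to\Omega$ a measurable, $\mu$-preserving and mixing map, i.e. $\mu(A\cap T^{-n}B)\to\mu(A)\mu(B)$ for all $A,B\in\mathcal A$. Let $\widehat T:\mathcal L^1\to\mathcal L^1$ be its transfer operator, defined by $\int \widehat T f\cdot g\,d\mu=\int f\cdot g\circ T\,d\mu$ for all $f\in\mathcal L^1$, $g\in\mathcal L^\infty$. Let $(\mathcal F,\|\cdot\|)$ be a complex Banach algebra of ($\mu$-a.e. classes of) measurable functions that contains the constants and satisfies $\|\varphi\|\ge|\varphi|_\infty$ (essential supremum) for all $\varphi\in\mathcal F$. Suppose that $\widehat T$ maps $\mathcal F$ to $\mathcal F$, is bounded there, and has a spectral gap on $\mathcal F$: $\widehat T|_{\mathcal F}=\lambda P+N$ with $\lambda\in\mathbb C$ and bounded operators $P,N$ on $\mathcal F$ such that $P^2=P$, $\dim\operatorname{Im}P=1$, $PN=NP=0$, and the spectral radius of $N$ is smaller than $|\lambda|$. Let $\chi:\Omega\to\mathbb R_{\ge0}$ be measurable. Suppose that there are $K_1,K_2>0$ such that for all $\ell>0$ the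 functions ${}^{\ell}\chi:=\chi\cdot\mathbf 1_{\{\chi\le\ell\}}$ and $\mathbf 1_{\{\chi>\ell\}}$ belong to $\mathcal F$, with $\|{}^{\ell}\chi\|\le K_1\ell$ and $\|\mathbf 1_{\{\chi>\ell\}}\|\le K_2$. For $\ell>0$ and $n\in\mathbb N$ put $\mathsf T_n^{\ell}\chi:=\sum_{k=1}^{n}{}^{\ell}\chi\circ T^{k-1}$. **Theorem.** Let $0<\alpha<1$ and assume $\mu(\chi>x)=L(x)/x^{\alpha}$ for all $x>0$, where $L$ is slowly varying, i.e. $L(cx)/L(x)\to1$ as $x\to\infty$ for every $c>0$. Let $(f_n)$ be a sequence of positive reals with $\liminf_{n\to\infty}\mu(0<\chi\le f_n)>0$. If there is $\psi:\mathbb N\to(0,\infty)$ with $\sum_n 1/\psi(n)<\infty$ and $$\frac{f_n^{\alpha}}{L(f_n)}=o\!\left(\frac{n}{\log\psi(\lfloor\log n\rfloor)}\right),$$ then $$\lim_{n\to\infty}\frac{\mathsf T_n^{f_n}\chi}{\int\mathsf T_n^{f_n}\chi\,d\mu}=1\quad\text{a.s.}$$ If additionally $f_n\to\infty$, then $$\int\mathsf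 T_n^{f_n}\chi\,d\mu\sim\frac{\alpha}{1-\alpha}\,n\,f_n^{1-\alpha}L(f_n),\qquad\text{and hence}\qquad \lim_{n\to\infty}\frac{\mathsf T_n^{f_n}\chi}{\frac{\alpha}{1-\alpha}\,n\,f_n^{1-\alpha}L(f_n)}=1\quad\text{a.s.}$$ -/

import Mathlib

open MeasureTheory Filter Topology Asymptotics

/-- `T` is a mixing transformation of the measure `μ`:
`μ (A ∩ T⁻ⁿ B) → μ A * μ B` for all measurable `A`, `B`. -/
def IsMixing {Ω : Type*} [MeasurableSpace Ω] (T : Ω → Ω) (μ : Measure Ω) : Prop :=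
  ∀ A B : Set Ω, MeasurableSet A → MeasurableSet B →
    Tendsto (fun n : ℕ => μ (A ∩ T^[n] ⁻¹' B)) atTop (𝓝 (μ A * μ B))

/-- `h` is the image of `f` under the transfer operator of `T`: `h` is the (a.e. unique) integrable
function with `∫ h * g = ∫ f * (g ∘ T)` for all `g ∈ L^∞`. -/
def IsTransferImage {Ω : Type*} [MeasurableSpace Ω] (T : Ω → Ω) (μ : Measure Ω)
    (f h : Ω → ℂ) : Prop :=
  Integrable h μ ∧
    ∀ g : Ω → ℂ, MemLp g ⊤ μ → ∫ ω, h ω * g ω ∂μ = ∫ ω, f ω * g (T ω) ∂μ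

/-- A bounded operator `U` on a complex Banach space has a spectral gap: `U = lam • P + N` with `P` a
projection onto a line, `P N = N P = 0`, and the spectral radius of `N` smaller than `|lam|`. -/
def HasSpectralGap {F : Type*} [NormedAddCommGroup F] [NormedSpace ℂ F] (U : F →L[ℂ] F) : Prop :=
  ∃ (lam : ℂ) (P N : F →L[ℂ] F),
    U = lam • P + N ∧
    P * P = P ∧
    Module.finrank ℂ (LinearMap.range (P : F →ₗ[ℂ] F)) = 1 ∧
    P * N = 0 ∧
    N * P = 0 ∧
    spectralRadius ℂ N < ‖lam‖ₑ

/-- The spectral gap setting for `(Ω, T, μ)` and a Banach algebra `F` of (a.e. classes of) complex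
measurable functions. The Banach algebra is the complete normed `ℂ`-algebra `F` together with the
injective linear and multiplicative map `ι` that sends an element to its class; as `ι 1 = 1`, the
image contains the constant functions. -/
structure SpectralGapSystem {Ω : Type*} [MeasurableSpace Ω] (T : Ω → Ω) (μ : Measure Ω)
    {F : Type*} [NormedCommRing F] [NormedAlgebra ℂ F] [CompleteSpace F]
    (ι : F →ₗ[ℂ] (Ω →ₘ[μ] ℂ)) : Prop where
  isProbabilityMeasure : IsProbabilityMeasure μ
  measurePreserving : MeasurePreserving T μ μ
  mixing : IsMixing T μ
  injective : Function.Injective ι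
  map_one : ι 1 = 1
  map_mul : ∀ a b : F, ι (a * b) = ι a * ι b
  essSup_le_norm : ∀ a : F, ∀ᵐ ω ∂μ, ‖ι a ω‖ ≤ ‖a‖
  /-- The transfer operator maps `F` to itself, is bounded there, and has a spectral gap. -/
  transfer : ∃ U : F →L[ℂ] F,
    (∀ a : F, IsTransferImage T μ (ι a) (ι (U a))) ∧ HasSpectralGap U

/-- The truncated observable `χ · 1_{χ ≤ ℓ}`. -/
noncomputable def trunc {Ω : Type*} (χ : Ω → ℝ) (ℓ : ℝ) : Ω → ℝ :=
  Set.indicator {ω | χ ω ≤ ℓ} χ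

/-- The spectral gap setting with a measurable observable `χ ≥ 0` such that the truncations of `χ` and
the indicators of `{χ > ℓ}` lie in `F`, with `‖χ · 1_{χ ≤ ℓ}‖ ≤ K₁ ℓ` and `‖1_{χ > ℓ}‖ ≤ K₂` for all
`ℓ > 0`. -/
structure ObservableSystem {Ω : Type*} [MeasurableSpace Ω] (T : Ω → Ω) (μ : Measure Ω)
    {F : Type*} [NormedCommRing F] [NormedAlgebra ℂ F] [CompleteSpace F]
    (ι : F →ₗ[ℂ] (Ω →ₘ[μ] ℂ)) (χ : Ω → ℝ) : Prop where
  spectralGapSystem : SpectralGapSystem T μ ι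
  measurable : Measurable χ
  nonneg : ∀ ω, 0 ≤ χ ω
  norm_trunc_le : ∃ K₁ : ℝ, 0 < K₁ ∧ ∀ ℓ : ℝ, 0 < ℓ →
    ∃ a : F, (ι a =ᵐ[μ] fun ω => (trunc χ ℓ ω : ℂ)) ∧ ‖a‖ ≤ K₁ * ℓ
  norm_indicator_le : ∃ K₂ : ℝ, 0 < K₂ ∧ ∀ ℓ : ℝ, 0 < ℓ →
    ∃ a : F, (ι a =ᵐ[μ] Set.indicator {ω | ℓ < χ ω} fun _ => (1 : ℂ)) ∧ ‖a‖ ≤ K₂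

/-- `L` is slowly varying (at infinity): `L (c x) ∼ L x` as `x → ∞`, for every `c > 0`. -/
def SlowlyVarying (L : ℝ → ℝ) : Prop :=
  ∀ c : ℝ, 0 < c → Tendsto (fun x => L (c * x) / L x) atTop (𝓝 1)

/-- The set of positive sequences `u` with `∑ 1 / u n < ∞`. -/
def PsiClass : Set (ℕ → ℝ) :=
  {u | (∀ n, 0 < u n) ∧ Summable fun n => 1 / u n}

/-- The truncated Birkhoff sum `∑_{k < n} (χ · 1_{χ ≤ ℓ}) ∘ T^k`. -/
noncomputable def truncSum {Ω : Type*} (T : Ω → Ω) (χ : Ω → ℝ) (ℓ : ℝ) (n : ℕ) (ω : Ω) : ℝ :=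
  birkhoffSum T (trunc χ ℓ) n ω

/-! Write q(x) = μ(χ > x) and let m(x) be the mean of χ truncated at x. The spectral gap and
T-invariance of μ turn the transfer operator into U a = (∫ a)·1 + N a, where N kills constants and
contracts an equivalent norm (`exists_decomposition`). For g with values in [0, 1], the integral of
∏ (1 + s g ∘ T^k) is the integral of an iterate of x ↦ U((1 + s g) x). Its growth per step is at
most 1 + s∫g + K s²∫g, with K depending only on a norm bound for g (`exists_integral_prod_le`).
Exponential Markov then yields deviations of probability at most 2 exp(-c n ∫g). For g = χ·1_{χ ≤ x}
/ x the norm bound does not depend on x, and the exponent is c n m(x)/x.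

Karamata's theorem gives m(x)/x ~ α/(1-α) q(x), so at x = f_n the exponent is of order n q(f_n),
which the growth condition makes larger than any multiple of log ψ(⌊log n⌋).

A union bound over all n would be too costly, and f need not be monotone. Times are therefore cut
into blocks of comparable n, and each block is sorted by the size of m(f_n). Within one class,
monotonicity in time and in level squeezes all sums between two extreme ones. The number of classes
is not bounded, but log(m(y)/m(x)) ≤ H q(x)/q(y) (`exists_log_mean_div_le`) makes the exponents grow
linearly over the classes, so a geometric series bounds the block (`exists_measure_block_le`). The
block bounds are summable because ∑ 1/ψ is, and Borel–Cantelli concludes. -/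

/-! ### Normal form of the transfer operator -/

/-- An operator of spectral radius smaller than `r` contracts by the factor `r` with respect to a
suitable equivalent norm. -/
theorem exists_adapted_seminorm {F : Type*} [NormedAddCommGroup F] [NormedSpace ℂ F]
    [CompleteSpace F] (N : F →L[ℂ] F) {r : ℝ} (hr : 0 < r)
    (h : spectralRadius ℂ N < ENNReal.ofReal r) :
    ∃ (p : Seminorm ℂ F) (D : ℝ), 0 < D ∧ (∀ x, ‖x‖ ≤ p x) ∧ (∀ x, p x ≤ D * ‖x‖) ∧
      ∀ x, p (N x) ≤ r * p x := by
  -- Gelfand's formula supplies k. The seminorm is ∑_{i<k} r⁻ⁱ‖Nⁱ x‖: replacing x by N x shifts the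
  -- sum by one index, trading the term ‖x‖ for r⁻ᵏ‖Nᵏ x‖ ≤ ‖x‖.
  obtain ⟨k, hk, hk1⟩ : ∃ k : ℕ, ‖N ^ k‖ ≤ r ^ k ∧ 1 ≤ k := by
    have h1 := (spectrum.pow_nnnorm_pow_one_div_tendsto_nhds_spectralRadius N).eventually_lt_const h
    obtain ⟨k, hk, hk1⟩ := (h1.and (eventually_ge_atTop 1)).exists
    refine ⟨k, ?_, hk1⟩
    have hk0 : (k : ℝ) ≠ 0 := by positivity
    have h2 : ((‖N ^ k‖₊ : ENNReal)) ≤ ENNReal.ofReal (r ^ k) := by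
      have h3 := ENNReal.rpow_le_rpow hk.le (Nat.cast_nonneg k : (0 : ℝ) ≤ k)
      rw [← ENNReal.rpow_mul, one_div, inv_mul_cancel₀ hk0, ENNReal.rpow_one,
        ENNReal.rpow_natCast, ← ENNReal.ofReal_pow hr.le] at h3
      exact h3
    have h4 : ENNReal.ofReal ‖N ^ k‖ ≤ ENNReal.ofReal (r ^ k) := by
      rwa [ofReal_norm]
    exact (ENNReal.ofReal_le_ofReal_iff (by positivity)).1 h4
  have hterm : ∀ i x, ‖(N ^ (i + 1)) x‖ = ‖(N ^ i) (N x)‖ := by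
    intro i x
    rw [pow_succ]; rfl
  refine ⟨Seminorm.of (fun x => ∑ i ∈ Finset.range k, (r⁻¹) ^ i * ‖(N ^ i) x‖) ?_ ?_,
    1 + ∑ i ∈ Finset.range k, (r⁻¹) ^ i * ‖N ^ i‖, ?_, ?_, ?_, ?_⟩
  · intro x y
    rw [← Finset.sum_add_distrib]
    refine Finset.sum_le_sum fun i _ => ?_
    rw [map_add, ← mul_add]
    gcongr
    exact norm_add_le _ _
  · intro c x
    rw [Finset.mul_sum]
    refine Finset.sum_congr rfl fun i _ => ?_
    rw [map_smul, norm_smul]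
    ring
  · positivity
  · intro x
    change ‖x‖ ≤ ∑ i ∈ Finset.range k, (r⁻¹) ^ i * ‖(N ^ i) x‖
    have := Finset.single_le_sum (f := fun i => (r⁻¹) ^ i * ‖(N ^ i) x‖)
      (fun i _ => by positivity) (Finset.mem_range.2 hk1 : 0 ∈ Finset.range k)
    simpa using this
  · intro x
    change ∑ i ∈ Finset.range k, (r⁻¹) ^ i * ‖(N ^ i) x‖ ≤ _
    rw [add_mul, Finset.sum_mul]
    have : ∑ i ∈ Finset.range k, (r⁻¹) ^ i * ‖(N ^ i) x‖ ≤
        ∑ i ∈ Finset.range k, (r⁻¹) ^ i * ‖N ^ i‖ * ‖x‖ := by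
      refine Finset.sum_le_sum fun i _ => ?_
      rw [mul_assoc]
      gcongr
      exact (N ^ i).le_opNorm x
    linarith [norm_nonneg x]
  · intro x
    change ∑ i ∈ Finset.range k, (r⁻¹) ^ i * ‖(N ^ i) (N x)‖ ≤
      r * ∑ i ∈ Finset.range k, (r⁻¹) ^ i * ‖(N ^ i) x‖
    have h1 : ∑ i ∈ Finset.range k, (r⁻¹) ^ i * ‖(N ^ i) (N x)‖ =
        r * ∑ i ∈ Finset.range k, (r⁻¹) ^ (i + 1) * ‖(N ^ (i + 1)) x‖ := by
      rw [Finset.mul_sum]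
      refine Finset.sum_congr rfl fun i _ => ?_
      rw [hterm, pow_succ]
      field_simp
    have h2 := Finset.sum_range_succ (fun i => (r⁻¹) ^ i * ‖(N ^ i) x‖) k
    rw [Finset.sum_range_succ'] at h2
    have h3 : (r⁻¹) ^ k * ‖(N ^ k) x‖ ≤ ‖x‖ := by
      calc (r⁻¹) ^ k * ‖(N ^ k) x‖ ≤ (r⁻¹) ^ k * (r ^ k * ‖x‖) := by
            gcongr
            exact ((N ^ k).le_opNorm x).trans (by gcongr)
        _ = ‖x‖ := by
            rw [← mul_assoc, ← mul_pow, inv_mul_cancel₀ hr.ne', one_pow, one_mul]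
    rw [h1]
    refine mul_le_mul_of_nonneg_left ?_ hr.le
    simp only [pow_zero, one_apply_eq_self, one_mul] at h2
    linarith

section SpectralGap

variable {Ω : Type*} [MeasurableSpace Ω] {T : Ω → Ω} {μ : Measure Ω}
    {F : Type*} [NormedCommRing F] [NormedAlgebra ℂ F]
    {ι : F →ₗ[ℂ] (Ω →ₘ[μ] ℂ)}

namespace SpectralGapSystem

theorem coeFn_add (ι : F →ₗ[ℂ] (Ω →ₘ[μ] ℂ)) (a b : F) :
    ι (a + b) =ᵐ[μ] fun ω => ι a ω + ι b ω := by
  rw [map_add]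
  exact AEEqFun.coeFn_add _ _

theorem coeFn_smul (ι : F →ₗ[ℂ] (Ω →ₘ[μ] ℂ)) (c : ℂ) (a : F) :
    ι (c • a) =ᵐ[μ] fun ω => c * ι a ω := by
  rw [map_smul]
  exact AEEqFun.coeFn_smul _ _

theorem integral_smul (ι : F →ₗ[ℂ] (Ω →ₘ[μ] ℂ)) (c : ℂ) (a : F) :
    ∫ ω, ι (c • a) ω ∂μ = c * ∫ ω, ι a ω ∂μ := by
  rw [integral_congr_ae (coeFn_smul ι c a), integral_const_mul]

theorem integral_transfer {U : F →L[ℂ] F}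
    (hU : ∀ a : F, IsTransferImage T μ (ι a) (ι (U a))) (a : F) :
    ∫ ω, ι (U a) ω ∂μ = ∫ ω, ι a ω ∂μ := by
  simpa using (hU a).2 (fun _ => 1) (memLp_top_const 1)

variable [CompleteSpace F]

theorem memLp_top (hS : SpectralGapSystem T μ ι) (a : F) : MemLp (ι a) ⊤ μ :=
  memLp_top_of_bound (ι a).aestronglyMeasurable ‖a‖ (hS.essSup_le_norm a)

theorem integrable (hS : SpectralGapSystem T μ ι) (a : F) : Integrable (ι a) μ := by
  have := hS.isProbabilityMeasure
  exact (hS.memLp_top a).integrable le_top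

theorem eq_of_forall_setIntegral_eq (hS : SpectralGapSystem T μ ι) {a b : F}
    (h : ∀ s, MeasurableSet s → ∫ ω in s, ι a ω ∂μ = ∫ ω in s, ι b ω ∂μ) : a = b := by
  apply hS.injective
  apply AEEqFun.ext
  exact Integrable.ae_eq_of_forall_setIntegral_eq _ _ (hS.integrable a) (hS.integrable b)
    fun s hs _ => h s hs

theorem ne_zero (hS : SpectralGapSystem T μ ι) : (1 : F) ≠ 0 := by
  intro h
  have hμ := hS.isProbabilityMeasure
  have h1 : (1 : Ω →ₘ[μ] ℂ) = 0 := by rw [← hS.map_one, h, map_zero]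
  have h2 : ∫ _ : Ω, (1 : ℂ) ∂μ = ∫ _ : Ω, (0 : ℂ) ∂μ := by
    apply integral_congr_ae
    have h3 := AEEqFun.coeFn_one (α := Ω) (μ := μ) (β := ℂ)
    rw [h1] at h3
    filter_upwards [h3, AEEqFun.coeFn_zero (α := Ω) (μ := μ) (β := ℂ)] with ω h4 h5
    rw [h5] at h4
    simpa using h4.symm
  simp at h2

theorem integral_one (hS : SpectralGapSystem T μ ι) : ∫ ω, ι 1 ω ∂μ = 1 := by
  have hμ := hS.isProbabilityMeasure
  rw [hS.map_one, integral_congr_ae AEEqFun.coeFn_one]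
  simp

theorem coeFn_one (hS : SpectralGapSystem T μ ι) : ι 1 =ᵐ[μ] fun _ => 1 := by
  rw [hS.map_one]
  exact AEEqFun.coeFn_one

theorem coeFn_mul (hS : SpectralGapSystem T μ ι) (a b : F) :
    ι (a * b) =ᵐ[μ] fun ω => ι a ω * ι b ω := by
  rw [hS.map_mul]
  exact AEEqFun.coeFn_mul _ _

theorem integral_add (hS : SpectralGapSystem T μ ι) (a b : F) :
    ∫ ω, ι (a + b) ω ∂μ = ∫ ω, ι a ω ∂μ + ∫ ω, ι b ω ∂μ := by
  rw [integral_congr_ae (coeFn_add ι a b), MeasureTheory.integral_add (hS.integrable a)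
    (hS.integrable b)]

theorem norm_integral_le (hS : SpectralGapSystem T μ ι) (a : F) : ‖∫ ω, ι a ω ∂μ‖ ≤ ‖a‖ := by
  have hμ := hS.isProbabilityMeasure
  simpa using norm_integral_le_of_norm_le_const (hS.essSup_le_norm a)

theorem transfer_one (hS : SpectralGapSystem T μ ι) {U : F →L[ℂ] F}
    (hU : ∀ a : F, IsTransferImage T μ (ι a) (ι (U a))) : U 1 = 1 := by
  apply hS.eq_of_forall_setIntegral_eq
  intro s hs
  have hμ := hS.isProbabilityMeasure
  have h1 := (hU 1).2 (s.indicator fun _ => 1) ((memLp_top_const 1).indicator hs)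
  have h2 : ∀ b : F, ∫ ω in s, ι b ω ∂μ = ∫ ω, ι b ω * s.indicator (fun _ => 1) ω ∂μ := by
    intro b
    rw [← integral_indicator hs]
    congr 1 with ω
    by_cases h : ω ∈ s <;> simp [h]
  rw [h2, h2, h1]
  have h3 : ∀ g : Ω → ℂ, ∫ ω, ι 1 ω * g ω ∂μ = ∫ ω, g ω ∂μ := fun g => by
    apply integral_congr_ae
    filter_upwards [hS.coeFn_one] with ω hω
    simp [hω]
  rw [h3, h3]
  have hm : AEStronglyMeasurable (s.indicator fun _ => (1 : ℂ)) (μ.map T) :=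
    (stronglyMeasurable_const.indicator hs).aestronglyMeasurable
  rw [← integral_map hS.measurePreserving.measurable.aemeasurable hm, hS.measurePreserving.map_eq]

/-- On eigenfunctions the transfer operator acts by factors of modulus at most one. -/
theorem norm_eigenvalue_le_one (hS : SpectralGapSystem T μ ι) {U : F →L[ℂ] F}
    (hU : ∀ a : F, IsTransferImage T μ (ι a) (ι (U a))) {lam : ℂ} {v : F} (hv : v ≠ 0)
    (h : U v = lam • v) : ‖lam‖ ≤ 1 := by
  by_contra! hlam
  apply hv
  have hμ := hS.isProbabilityMeasure
  -- By duality, lam ∫_s v = ∫_{T⁻¹ s} v, so the powers of lam times ∫_s v stay bounded by ‖v‖. For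
  -- |lam| > 1 every set integral must vanish.
  have key : ∀ n : ℕ, ∀ s, MeasurableSet s → ‖lam‖ ^ n * ‖∫ ω in s, ι v ω ∂μ‖ ≤ ‖v‖ := by
    intro n
    induction n with
    | zero =>
      intro s hs
      have h1 := norm_setIntegral_le_of_norm_le_const_ae (s := s) (f := ι v) (C := ‖v‖)
        (measure_lt_top μ s) (ae_restrict_of_ae (hS.essSup_le_norm v))
      rw [pow_zero, one_mul]
      refine h1.trans (mul_le_of_le_one_right (norm_nonneg _) ?_)
      exact measureReal_le_one
    | succ n ih =>
      intro s hs
      have h1 := (hU v).2 (s.indicator fun _ => 1) ((memLp_top_const 1).indicator hs)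
      have h2 : ∫ ω, ι (U v) ω * s.indicator (fun _ => 1) ω ∂μ =
          lam * ∫ ω in s, ι v ω ∂μ := by
        rw [h, ← integral_indicator hs, ← integral_const_mul]
        apply integral_congr_ae
        filter_upwards [coeFn_smul ι lam v] with ω hω
        rw [hω]
        by_cases h : ω ∈ s <;> simp [h]
      have hs' : MeasurableSet (T ⁻¹' s) := hS.measurePreserving.measurable hs
      have h3 : ∫ ω, ι v ω * s.indicator (fun _ => 1) (T ω) ∂μ = ∫ ω in T ⁻¹' s, ι v ω ∂μ := by
        rw [← integral_indicator hs']
        congr 1 with ω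
        by_cases h : T ω ∈ s <;> simp [h]
      rw [h2, h3] at h1
      have := ih _ hs'
      rw [← h1, norm_mul] at this
      rw [pow_succ, mul_assoc]
      exact this
  apply hS.eq_of_forall_setIntegral_eq
  intro s hs
  have h0 : ∫ ω in s, ι (0 : F) ω ∂μ = 0 := by
    rw [map_zero]
    exact integral_eq_zero_of_ae (ae_restrict_of_ae AEEqFun.coeFn_zero)
  rw [h0]
  by_contra hne
  obtain ⟨n, hn⟩ := pow_unbounded_of_one_lt (‖v‖ / ‖∫ ω in s, ι v ω ∂μ‖) hlam
  rw [div_lt_iff₀ (norm_pos_iff.2 hne)] at hn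
  exact absurd (key n s hs) (not_le.2 hn)

/-- The transfer operator is the integral plus a contraction of an equivalent norm. -/
theorem exists_decomposition (hS : SpectralGapSystem T μ ι) :
    ∃ (U N : F →L[ℂ] F) (p : Seminorm ℂ F) (D r : ℝ),
      (∀ a : F, IsTransferImage T μ (ι a) (ι (U a))) ∧
      (∀ a : F, U a = (∫ ω, ι a ω ∂μ) • (1 : F) + N a) ∧ N 1 = 0 ∧
      0 < D ∧ (∀ x, ‖x‖ ≤ p x) ∧ (∀ x, p x ≤ D * ‖x‖) ∧ 0 < r ∧ r < 1 ∧
      ∀ x, p (N x) ≤ r * p x := by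
  obtain ⟨U, hU, lam, P, N, hUPN, hPP, hrank, hPN, hNP, hrad⟩ := hS.transfer
  obtain ⟨r, hr1, hr2⟩ := ENNReal.lt_iff_exists_nnreal_btwn.1 hrad
  have hr0 : (0 : ℝ) < r := by
    rw [NNReal.coe_pos]
    exact ENNReal.coe_pos.1 (bot_le.trans_lt hr1)
  have hrlam : (r : ℝ) < ‖lam‖ := by
    rw [← ofReal_norm, ← ENNReal.ofReal_coe_nnreal] at hr2
    exact (ENNReal.ofReal_lt_ofReal_iff_of_nonneg r.2).1 hr2
  rw [← ENNReal.ofReal_coe_nnreal] at hr1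
  obtain ⟨p, D, hD, hp1, hp2, hpN⟩ := exists_adapted_seminorm N hr0 hr1
  have hUa : ∀ a, U a = lam • P a + N a := fun a => by rw [hUPN]; rfl
  have hPPa : ∀ a, P (P a) = P a := fun a => congrArg (fun A : F →L[ℂ] F => A a) hPP
  have hPNa : ∀ a, P (N a) = 0 := fun a => congrArg (fun A : F →L[ℂ] F => A a) hPN
  have hNPa : ∀ a, N (P a) = 0 := fun a => congrArg (fun A : F →L[ℂ] F => A a) hNP
  have hU1 := hS.transfer_one hU
  obtain ⟨⟨v, w, hw⟩, hv0, hv⟩ := finrank_eq_one_iff'.1 hrank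
  have hw' : P w = v := hw
  have hv0' : v ≠ 0 := fun h => hv0 (Subtype.ext h)
  -- Any vector on the line Im P is an eigenvector for lam, which forces r < |lam| ≤ 1 and makes N a
  -- genuine contraction.
  have hlam1 : ‖lam‖ ≤ 1 := by
    refine hS.norm_eigenvalue_le_one hU hv0' ?_
    rw [hUa, ← hw', hPPa, hNPa, add_zero]
  have hr3 : (r : ℝ) < 1 := hrlam.trans_le hlam1
  have hiter : ∀ (n : ℕ) x, ‖(N ^ n) x‖ ≤ (r : ℝ) ^ n * (D * ‖x‖) := by
    intro n x
    refine (hp1 _).trans (le_trans ?_ (mul_le_mul_of_nonneg_left (hp2 x) (by positivity)))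
    induction n with
    | zero => simp
    | succ n ih =>
      have : (N ^ (n + 1)) x = N ((N ^ n) x) := by rw [pow_succ']; rfl
      rw [this, pow_succ']
      refine (hpN _).trans ?_
      rw [mul_assoc]
      gcongr
  have hlim : ∀ x, Tendsto (fun n : ℕ => (N ^ n) x) atTop (𝓝 0) := by
    intro x
    refine squeeze_zero_norm (hiter · x) ?_
    have := (tendsto_pow_atTop_nhds_zero_of_lt_one hr0.le hr3).mul_const (D * ‖x‖)
    simpa using this
  have hfix : ∀ x, N x = x → x = 0 := by
    intro x hx
    have : ∀ n : ℕ, (N ^ n) x = x := by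
      intro n
      induction n with
      | zero => simp
      | succ n ih =>
        have : (N ^ (n + 1)) x = N ((N ^ n) x) := by rw [pow_succ']; rfl
        rw [this, ih, hx]
    have h1 := hlim x
    simp only [this] at h1
    exact tendsto_nhds_unique tendsto_const_nhds h1
  have hP1 : lam • P 1 = P 1 := by
    have := hUa 1
    rw [hU1] at this
    have h2 := congrArg P this
    rw [map_add, hPNa, map_smul, hPPa, add_zero] at h2
    exact h2.symm
  -- Otherwise 1 = U 1 = N 1, and the contraction N has no nonzero fixed point. With lam • P 1 = P 1
  -- this gives lam = 1.
  have hP10 : P 1 ≠ 0 := by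
    intro h0
    have := hUa 1
    rw [hU1, h0, smul_zero, zero_add] at this
    exact hS.ne_zero (hfix 1 this.symm)
  have hlam : lam = 1 := by
    have : (lam - 1) • P 1 = 0 := by rw [sub_smul, hP1, one_smul, sub_self]
    rcases smul_eq_zero.1 this with h | h
    · exact sub_eq_zero.1 h
    · exact absurd h hP10
  subst hlam
  simp only [one_smul] at hUa
  have hN1 : N 1 = 0 := by
    have h1 : N (1 - P 1) = 1 - P 1 := by
      have := hUa 1
      rw [hU1] at this
      rw [map_sub, hNPa, sub_zero, eq_sub_iff_add_eq, add_comm, ← this]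
    have h2 := hfix _ h1
    rw [sub_eq_zero.1 h2, hNPa]
  have hP11 : P 1 = 1 := by
    have := hUa 1
    rw [hU1, hN1, add_zero] at this
    exact this.symm
  have hPc : ∀ a, ∃ c : ℂ, P a = c • (1 : F) := by
    intro a
    obtain ⟨c, hc⟩ := hv ⟨P a, a, rfl⟩
    obtain ⟨d, hd⟩ := hv ⟨1, 1, hP11⟩
    have hc' : c • v = P a := congrArg Subtype.val hc
    have hd' : d • v = 1 := congrArg Subtype.val hd
    have hd0 : d ≠ 0 := by
      rintro rfl
      rw [zero_smul] at hd'
      exact hS.ne_zero hd'.symm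
    refine ⟨c * d⁻¹, ?_⟩
    rw [← hc', ← hd', smul_smul, mul_assoc, inv_mul_cancel₀ hd0, mul_one]
  have hintN : ∀ a, ∫ ω, ι (N a) ω ∂μ = ∫ ω, ι a ω ∂μ - ∫ ω, ι (P a) ω ∂μ := by
    intro a
    have := integral_transfer hU a
    rw [hUa, hS.integral_add] at this
    rw [← this]; ring
  -- On ker P, N preserves the integral while Nⁿ a → 0. Hence P a is the constant ∫ a.
  have hker : ∀ a, P a = 0 → ∫ ω, ι a ω ∂μ = 0 := by
    intro a ha
    have h1 : ∀ n : ℕ, P ((N ^ n) a) = 0 ∧ ∫ ω, ι ((N ^ n) a) ω ∂μ = ∫ ω, ι a ω ∂μ := by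
      intro n
      induction n with
      | zero => simp [ha]
      | succ n ih =>
        have : (N ^ (n + 1)) a = N ((N ^ n) a) := by rw [pow_succ']; rfl
        rw [this]
        refine ⟨hPNa _, ?_⟩
        rw [hintN, ih.1, ih.2, map_zero, integral_congr_ae AEEqFun.coeFn_zero]
        simp
    have h2 : Tendsto (fun n : ℕ => ∫ ω, ι ((N ^ n) a) ω ∂μ) atTop (𝓝 0) :=
      squeeze_zero_norm (fun n => hS.norm_integral_le _) (tendsto_zero_iff_norm_tendsto_zero.1 (hlim a))
    simp only [(h1 _).2] at h2
    exact tendsto_nhds_unique tendsto_const_nhds h2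
  refine ⟨U, N, p, D, r, hU, ?_, hN1, hD, hp1, hp2, hr0, hr3, hpN⟩
  intro a
  obtain ⟨c, hc⟩ := hPc a
  have h1 : ∫ ω, ι (a - P a) ω ∂μ = 0 := hker _ (by rw [map_sub, hPPa, sub_self])
  have h2 := hS.integral_add (a - P a) (P a)
  rw [sub_add_cancel, h1, hc, integral_smul, hS.integral_one, zero_add, mul_one] at h2
  rw [hUa, hc, h2]

end SpectralGapSystem

end SpectralGap

/-! ### Moment generating bound and large deviations -/

/-- Lets the exponential in Markov's inequality be replaced by 1 + s g, which is affine in g and so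
belongs to F with controlled norm. The loss is of second order only. -/
theorem exp_sub_sq_le_one_add {x : ℝ} (hx : |x| ≤ 1 / 2) : Real.exp (x - x ^ 2) ≤ 1 + x := by
  obtain ⟨h1, h2⟩ := abs_le.1 hx
  rcases le_total 0 x with h | h
  · have h3 : |x - x ^ 2| ≤ 1 := by rw [abs_le]; constructor <;> nlinarith
    have h4 := (abs_le.1 (Real.abs_exp_sub_one_sub_id_le h3)).2
    nlinarith [mul_nonneg h (sq_nonneg x), mul_nonneg (mul_nonneg h (sq_nonneg x)) (sub_nonneg.2 h2)]
  · have h3 : 0 ≤ x ^ 2 - x := by nlinarith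
    have h4 := Real.quadratic_le_exp_of_nonneg h3
    have h5 : x - x ^ 2 = -(x ^ 2 - x) := by ring
    rw [h5, Real.exp_neg, inv_le_iff_one_le_mul₀ (Real.exp_pos _)]
    have h6 : 0 ≤ 1 + x := by linarith
    refine le_trans ?_ (mul_le_mul_of_nonneg_left h4 h6)
    have h7 : (1 + x) * (1 + (x ^ 2 - x) + (x ^ 2 - x) ^ 2 / 2) - 1 =
        x ^ 2 * ((1 + x) * (1 - x) ^ 2 / 2 + x) := by ring
    have h8 : 0 ≤ (1 + x) * (1 - x) ^ 2 / 2 + x := by nlinarith [sq_nonneg x]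
    nlinarith [mul_nonneg (sq_nonneg x) h8]

section Deviation

variable {Ω : Type*} [MeasurableSpace Ω] {T : Ω → Ω} {μ : Measure Ω}
    {F : Type*} [NormedCommRing F] [NormedAlgebra ℂ F] [CompleteSpace F]
    {ι : F →ₗ[ℂ] (Ω →ₘ[μ] ℂ)}

namespace SpectralGapSystem

/-- The integral of a product along an orbit is the integral of an iterated twisted transfer
operator. -/
theorem integral_iterate_twisted (hS : SpectralGapSystem T μ ι) {U : F →L[ℂ] F}
    (hU : ∀ a : F, IsTransferImage T μ (ι a) (ι (U a))) {w : Ω → ℂ} (hw : Measurable w) {C : ℝ}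
    (hC : ∀ ω, ‖w ω‖ ≤ C) {h : F} (hh : ι h =ᵐ[μ] w) (n : ℕ) :
    ∀ (W : Ω → ℂ), Measurable W → ∀ C' : ℝ, (∀ ω, ‖W ω‖ ≤ C') →
      ∫ ω, ι ((fun x => U (h * x))^[n] 1) ω * W ω ∂μ =
        ∫ ω, (∏ k ∈ Finset.range n, w (T^[k] ω)) * W (T^[n] ω) ∂μ := by
  have hT := hS.measurePreserving.measurable
  induction n with
  | zero =>
    intro W _ _ _
    apply integral_congr_ae
    filter_upwards [hS.coeFn_one] with ω hω
    simp [hω]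
  | succ n ih =>
    intro W hW C' hC'
    rw [Function.iterate_succ_apply']
    set φ := (fun x => U (h * x))^[n] 1
    rw [(hU (h * φ)).2 W (memLp_top_of_bound hW.aestronglyMeasurable C' (ae_of_all _ hC'))]
    have h1 : ∫ ω, ι (h * φ) ω * W (T ω) ∂μ = ∫ ω, ι φ ω * (w ω * W (T ω)) ∂μ := by
      apply integral_congr_ae
      filter_upwards [hS.coeFn_mul h φ, hh] with ω h2 h3
      rw [h2, h3]; ring
    rw [h1, ih (fun ω => w ω * W (T ω)) (hw.mul (hW.comp hT)) (C * C') ?_]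
    · congr 1 with ω
      rw [Finset.prod_range_succ, Function.iterate_succ_apply']
      ring
    · intro ω
      rw [norm_mul]
      exact mul_le_mul (hC ω) (hC' _) (norm_nonneg _) ((norm_nonneg _).trans (hC ω))

/-- The factor ∫ g, in place of the supremum of g, makes the error terms proportional to the mean.
This is why the final exponent is linear in ∫ g. -/
theorem norm_integral_mul_le (hS : SpectralGapSystem T μ ι) {g : Ω → ℝ} (hg : Measurable g)
    (hg0 : ∀ ω, 0 ≤ g ω) (hg1 : ∀ ω, g ω ≤ 1) {a : F} (ha : ι a =ᵐ[μ] fun ω => (g ω : ℂ)) (x : F) :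
    ‖∫ ω, ι (a * x) ω ∂μ‖ ≤ (∫ ω, g ω ∂μ) * ‖x‖ := by
  have hμ := hS.isProbabilityMeasure
  have hint : Integrable g μ := Integrable.of_bound hg.aestronglyMeasurable 1
    (ae_of_all _ fun ω => by rw [Real.norm_eq_abs, abs_of_nonneg (hg0 ω)]; exact hg1 ω)
  rw [← integral_mul_const]
  refine norm_integral_le_of_norm_le (hint.mul_const _) ?_
  filter_upwards [hS.coeFn_mul a x, ha, hS.essSup_le_norm x] with ω h1 h2 h3
  rw [h1, h2, norm_mul, Complex.norm_real, Real.norm_eq_abs, abs_of_nonneg (hg0 ω)]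
  exact mul_le_mul_of_nonneg_left h3 (hg0 ω)

/-- A moment generating bound, with constants that depend on the observable only through a bound
on its norm. -/
theorem exists_integral_prod_le (hS : SpectralGapSystem T μ ι) {K₁ : ℝ} (hK₁ : 0 < K₁) :
    ∃ K s₀ : ℝ, 0 < K ∧ 0 < s₀ ∧ s₀ ≤ 1 / 2 ∧ ∀ g : Ω → ℝ, Measurable g → (∀ ω, 0 ≤ g ω) →
      (∀ ω, g ω ≤ 1) → ∀ a : F, ι a =ᵐ[μ] (fun ω => (g ω : ℂ)) → ‖a‖ ≤ K₁ → ∀ s : ℝ, |s| ≤ s₀ →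
      ∀ n : ℕ, ∫ ω, ∏ k ∈ Finset.range n, (1 + s * g (T^[k] ω)) ∂μ ≤
        (1 + s * (∫ ω, g ω ∂μ) + K * s ^ 2 * ∫ ω, g ω ∂μ) ^ n := by
  have hμ := hS.isProbabilityMeasure
  obtain ⟨U, N, p, D, r, hU, hUN, hN1, hD, hp1, hp2, hr0, hr1, hpN⟩ := hS.exists_decomposition
  set M := D * K₁ with hM
  have hM0 : 0 < M := by positivity
  have h1r : 0 < 1 - r := by linarith
  -- K is B M with the weight B = 2/(1 - r) used below. The bound |s|(M + 1) ≤ (1 - r)/2 is what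
  -- `hcoef` needs.
  refine ⟨2 / (1 - r) * M, min (1 / 2) ((1 - r) / (2 * (M + 1))), by positivity, by positivity,
    min_le_left _ _, ?_⟩
  intro g hg hg0 hg1 a ha haK s hs n
  have hs1 : |s| ≤ 1 / 2 := hs.trans (min_le_left _ _)
  have hs2 : |s| * (M + 1) ≤ (1 - r) / 2 := by
    have := hs.trans (min_le_right _ _)
    rw [le_div_iff₀ (by positivity)] at this
    linarith
  set G := ∫ ω, g ω ∂μ with hG
  have hG0 : 0 ≤ G := integral_nonneg hg0
  have hG1 : G ≤ 1 := by
    have := integral_mono_of_nonneg (ae_of_all μ hg0) (integrable_const 1) (ae_of_all μ hg1)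
    simpa using this
  have hsabs := abs_le.1 (le_refl |s|)
  have hsG : 0 ≤ 1 + s * G := by nlinarith [abs_nonneg s]
  set E : F → ℂ := fun x => ∫ ω, ι x ω ∂μ with hE
  have hEa : E a = (G : ℂ) := by
    rw [hE, hG, ← integral_complex_ofReal]
    exact integral_congr_ae ha
  set h : F := 1 + (s : ℂ) • a with hh
  have hhw : ι h =ᵐ[μ] fun ω => ((1 + s * g ω : ℝ) : ℂ) := by
    filter_upwards [coeFn_add ι 1 ((s : ℂ) • a), hS.coeFn_one, coeFn_smul ι (s : ℂ) a, ha]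
      with ω h1 h2 h3 h4
    rw [hh, h1, h2, h3, h4]
    push_cast
    ring
  set φ : ℕ → F := fun n => (fun x => U (h * x))^[n] 1 with hφ
  have hφs : ∀ n, φ (n + 1) = U (h * φ n) := fun n => Function.iterate_succ_apply' _ _ _
  have hprod : ∀ n, E (φ n) =
      ((∫ ω, ∏ k ∈ Finset.range n, (1 + s * g (T^[k] ω)) ∂μ : ℝ) : ℂ) := by
    intro n
    have hwm : Measurable fun ω => ((1 + s * g ω : ℝ) : ℂ) :=
      Complex.measurable_ofReal.comp ((hg.const_mul s).const_add 1)
    have h1 := hS.integral_iterate_twisted hU (w := fun ω => ((1 + s * g ω : ℝ) : ℂ)) hwm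
      (C := 2) (fun ω => ?_) hhw n (fun _ => 1) measurable_const 1 (fun _ => by simp)
    · simp only [mul_one] at h1
      rw [← integral_complex_ofReal, hE]
      simp only [hφ, h1]
      congr 1 with ω
      push_cast
      rfl
    · rw [Complex.norm_real, Real.norm_eq_abs, abs_le]
      have := hg0 ω
      have := hg1 ω
      have := hsabs.1
      have := hsabs.2
      constructor <;> nlinarith [abs_nonneg s]
  -- The mean-zero part of φ n. Since N kills constants, the pair (E (φ n), ψ n) satisfies a closed
  -- recursion with coupling of size |s|.
  set ψ : ℕ → F := fun n => φ n - E (φ n) • (1 : F) with hψ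
  have hφψ : ∀ n, φ n = E (φ n) • (1 : F) + ψ n := fun n => by simp [hψ]
  have haφ : ∀ n, a * φ n = E (φ n) • a + a * ψ n := by
    intro n
    conv_lhs => rw [hφψ n]
    rw [mul_add, mul_smul_comm, mul_one]
  have hhφ : ∀ n, h * φ n = φ n + (s : ℂ) • (a * φ n) := by
    intro n
    rw [hh, add_mul, one_mul, smul_mul_assoc]
  have hEs : ∀ n, E (φ (n + 1)) = E (φ n) * (1 + s * G) + s * E (a * ψ n) := by
    intro n
    have h1 : E (φ (n + 1)) = E (h * φ n) := by rw [hφs]; exact integral_transfer hU _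
    have h2 : E (h * φ n) = E (φ n) + s * (E (φ n) * E a + E (a * ψ n)) := by
      rw [hhφ, haφ]
      simp only [hE]
      rw [hS.integral_add, integral_smul, hS.integral_add, integral_smul]
    rw [h1, h2, hEa]; ring
  have hψs : ∀ n, ψ (n + 1) = N (ψ n) + (s : ℂ) • (E (φ n) • N a + N (a * ψ n)) := by
    intro n
    have h1 : ψ (n + 1) = N (h * φ n) := by
      have h2 : E (φ (n + 1)) = E (h * φ n) := by rw [hφs]; exact integral_transfer hU _
      have h3 := hUN (h * φ n)
      rw [← hφs] at h3
      simp only [hψ]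
      rw [h2, h3]
      simp [hE]
    have h2 : N (φ n) = N (ψ n) := by
      have := congrArg N (hφψ n)
      rwa [map_add, map_smul, hN1, smul_zero, zero_add] at this
    rw [h1, hhφ, haφ, map_add, h2, map_smul, map_add, map_smul]
  have hpa : p (N a) ≤ M := by
    refine (hpN a).trans ?_
    calc r * p a ≤ 1 * p a := by gcongr
      _ ≤ D * ‖a‖ := by rw [one_mul]; exact hp2 a
      _ ≤ M := by rw [hM]; gcongr
  have hpaψ : ∀ n, p (N (a * ψ n)) ≤ M * p (ψ n) := by
    intro n
    refine (hpN _).trans ?_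
    calc r * p (a * ψ n) ≤ 1 * p (a * ψ n) := by gcongr
      _ ≤ D * ‖a * ψ n‖ := by rw [one_mul]; exact hp2 _
      _ ≤ D * (K₁ * p (ψ n)) := by
          gcongr
          exact (norm_mul_le _ _).trans
            (mul_le_mul haK (hp1 _) (norm_nonneg _) hK₁.le)
      _ = M * p (ψ n) := by rw [hM]; ring
  have hb : ∀ n, p (ψ (n + 1)) ≤ r * p (ψ n) + |s| * (‖E (φ n)‖ * M + M * p (ψ n)) := by
    intro n
    rw [hψs]
    refine (map_add_le_add p _ _).trans ?_
    rw [map_smul_eq_mul, Complex.norm_real, Real.norm_eq_abs]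
    gcongr
    · exact hpN _
    · refine (map_add_le_add p _ _).trans ?_
      rw [map_smul_eq_mul]
      gcongr
      exact hpaψ n
  have hc : ∀ n, ‖E (φ (n + 1))‖ ≤ ‖E (φ n)‖ * (1 + s * G) + |s| * (G * p (ψ n)) := by
    intro n
    rw [hEs]
    refine (norm_add_le _ _).trans ?_
    rw [norm_mul, norm_mul, Complex.norm_real, Real.norm_eq_abs]
    have h1 : ‖(1 + s * G : ℂ)‖ = 1 + s * G := by
      rw [← abs_of_nonneg hsG, ← Real.norm_eq_abs, ← Complex.norm_real]
      push_cast
      rfl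
    rw [h1]
    gcongr
    exact (hS.norm_integral_mul_le hg hg0 hg1 ha _).trans
      (mul_le_mul_of_nonneg_left (hp1 _) hG0)
  set B := 2 / (1 - r) with hB
  have hB0 : 0 < B := by positivity
  have hBr : B * (1 - r) = 2 := by rw [hB]; field_simp
  -- A Lyapunov functional: the mean-zero part is weighted by |s| G B so that contraction of p
  -- absorbs the feedback |s| G p(ψ n) into the mean. What remains is a growth of order s² G per
  -- step.
  have hV : ∀ n, ‖E (φ n)‖ + |s| * G * B * p (ψ n) ≤ (1 + s * G + B * M * s ^ 2 * G) ^ n := by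
    intro n
    induction n with
    | zero =>
      have h1 : φ 0 = 1 := rfl
      have h2 : E 1 = 1 := hS.integral_one
      simp [hψ, h1, h2]
    | succ n ih =>
      have hpn := apply_nonneg p (ψ n)
      have hcn := norm_nonneg (E (φ n))
      have hsg : 0 ≤ |s| * G := by positivity
      have h1 : |s| * G * B * p (ψ (n + 1)) ≤
          |s| * G * B * (r * p (ψ n) + |s| * (‖E (φ n)‖ * M + M * p (ψ n))) :=
        mul_le_mul_of_nonneg_left (hb n) (by positivity)
      have hcoef : 1 + B * (r + |s| * M) ≤ B * (1 + s * G) := by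
        have h2 : -|s| ≤ s * G := by nlinarith [abs_nonneg s, hsabs.1]
        nlinarith
      have h3 : |s| * G * p (ψ n) * (1 + B * (r + |s| * M)) ≤
          |s| * G * p (ψ n) * (B * (1 + s * G)) :=
        mul_le_mul_of_nonneg_left hcoef (by positivity)
      have hss : |s| * |s| = s ^ 2 := by rw [← sq, sq_abs]
      have h4 : 0 ≤ |s| * G * B * p (ψ n) * (B * M * s ^ 2 * G) := by positivity
      have h5 : 0 ≤ 1 + s * G + B * M * s ^ 2 * G := by positivity
      rw [pow_succ]
      refine le_trans ?_ (mul_le_mul_of_nonneg_right ih h5)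
      have h6 : |s| * G * B * (|s| * (‖E (φ n)‖ * M)) = ‖E (φ n)‖ * (B * M * s ^ 2 * G) := by
        rw [← hss]; ring
      linear_combination hc n + h1 + h3 + h4 + h6
  have h1 := hV n
  have h2 : ∫ ω, ∏ k ∈ Finset.range n, (1 + s * g (T^[k] ω)) ∂μ ≤ ‖E (φ n)‖ := by
    rw [hprod n, Complex.norm_real]
    exact le_abs_self _
  have h3 : 0 ≤ |s| * G * B * p (ψ n) := by
    have := apply_nonneg p (ψ n)
    positivity
  linarith

/-- A large deviation inequality for Birkhoff sums, uniform over observables with values in `[0, 1]`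
and bounded norm. -/
theorem exists_deviation_le (hS : SpectralGapSystem T μ ι) {K₁ : ℝ} (hK₁ : 0 < K₁) {ε : ℝ}
    (hε : 0 < ε) :
    ∃ c : ℝ, 0 < c ∧ ∀ g : Ω → ℝ, Measurable g → (∀ ω, 0 ≤ g ω) → (∀ ω, g ω ≤ 1) →
      ∀ a : F, ι a =ᵐ[μ] (fun ω => (g ω : ℂ)) → ‖a‖ ≤ K₁ → ∀ n : ℕ,
      μ.real {ω | ε * (n * ∫ ω, g ω ∂μ) ≤ |birkhoffSum T g n ω - n * ∫ ω, g ω ∂μ|} ≤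
        2 * Real.exp (-(c * (n * ∫ ω, g ω ∂μ))) := by
  have hμ := hS.isProbabilityMeasure
  have hT := hS.measurePreserving.measurable
  obtain ⟨K, s₀, hK, hs₀, hs₀1, hbound⟩ := hS.exists_integral_prod_le hK₁
  -- C is the coefficient of t² in the upper-tail exponent n G (-ε t + C t²). The choice of t lets
  -- the quadratic term consume at most half of the gain ε t.
  set C := K + 1 + ε with hC
  have hC0 : 0 < C := by positivity
  set t := min s₀ (ε / (2 * C)) with ht
  have ht0 : 0 < t := by positivity
  have hts : t ≤ s₀ := min_le_left _ _
  have htC : C * t ≤ ε / 2 := by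
    have : t ≤ ε / (2 * C) := min_le_right _ _
    rw [le_div_iff₀ (by positivity)] at this
    linarith
  refine ⟨ε * t / 2, by positivity, ?_⟩
  intro g hg hg0 hg1 a ha haK n
  set G := ∫ ω, g ω ∂μ with hG
  have hG0 : 0 ≤ G := integral_nonneg hg0
  have hnG : 0 ≤ n * G := by positivity
  have hgT : ∀ k, Measurable fun ω => g (T^[k] ω) := fun k => hg.comp (hT.iterate k)
  have hmarkov : ∀ s y : ℝ, |s| ≤ s₀ →
      μ.real {ω | y ≤ (s - s ^ 2) * birkhoffSum T g n ω} ≤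
        Real.exp (n * G * (s + K * s ^ 2) - y) := by
    intro s y hs
    have hx : ∀ ω k, |s * g (T^[k] ω)| ≤ 1 / 2 := by
      intro ω k
      rw [abs_mul, abs_of_nonneg (hg0 _)]
      have := hg1 (T^[k] ω)
      have := hg0 (T^[k] ω)
      nlinarith [abs_nonneg s]
    have hx0 : ∀ ω k, 0 ≤ 1 + s * g (T^[k] ω) := fun ω k => by
      have := (abs_le.1 (hx ω k)).1
      linarith
    -- As 0 ≤ g ≤ 1, g² ≤ g, hence (s - s²) g ≤ s g - (s g)².
    have hle : ∀ ω, Real.exp ((s - s ^ 2) * birkhoffSum T g n ω) ≤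
        ∏ k ∈ Finset.range n, (1 + s * g (T^[k] ω)) := by
      intro ω
      rw [birkhoffSum, Finset.mul_sum, Real.exp_sum]
      refine Finset.prod_le_prod (fun _ _ => (Real.exp_pos _).le) fun k _ => ?_
      refine le_trans (Real.exp_le_exp.2 ?_) (exp_sub_sq_le_one_add (hx ω k))
      have := hg1 (T^[k] ω)
      have := hg0 (T^[k] ω)
      have h3 : g (T^[k] ω) ^ 2 ≤ g (T^[k] ω) := by nlinarith
      nlinarith [mul_le_mul_of_nonneg_left h3 (sq_nonneg s)]
    have hint : Integrable (fun ω => ∏ k ∈ Finset.range n, (1 + s * g (T^[k] ω))) μ := by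
      refine Integrable.of_bound (Finset.measurable_prod _ fun k _ =>
        ((hgT k).const_mul s).const_add 1).aestronglyMeasurable (2 ^ n) (ae_of_all _ fun ω => ?_)
      rw [Real.norm_eq_abs, abs_of_nonneg (Finset.prod_nonneg fun k _ => hx0 ω k)]
      calc ∏ k ∈ Finset.range n, (1 + s * g (T^[k] ω)) ≤ ∏ _k ∈ Finset.range n, (2 : ℝ) :=
            Finset.prod_le_prod (fun k _ => hx0 ω k) fun k _ => by
              have := (abs_le.1 (hx ω k)).2
              linarith
        _ = 2 ^ n := by simp
    have h1 := mul_meas_ge_le_integral_of_nonneg (μ := μ)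
      (ae_of_all _ fun ω => Finset.prod_nonneg fun k _ => hx0 ω k) hint (Real.exp y)
    have h2 : μ.real {ω | y ≤ (s - s ^ 2) * birkhoffSum T g n ω} ≤
        μ.real {ω | Real.exp y ≤ ∏ k ∈ Finset.range n, (1 + s * g (T^[k] ω))} :=
      measureReal_mono fun ω hω => (Real.exp_le_exp.2 hω).trans (hle ω)
    have h3 := hbound g hg hg0 hg1 a ha haK s hs n
    have h4 : (1 + s * G + K * s ^ 2 * G) ^ n ≤ Real.exp (n * G * (s + K * s ^ 2)) := by
      have h5 : 0 ≤ 1 + s * G + K * s ^ 2 * G := by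
        have hG1 : G ≤ 1 := by
          have := integral_mono_of_nonneg (ae_of_all μ hg0) (integrable_const 1) (ae_of_all μ hg1)
          simpa using this
        have : 0 ≤ K * s ^ 2 * G := by positivity
        nlinarith [neg_abs_le s, abs_nonneg s]
      have h6 : 1 + s * G + K * s ^ 2 * G ≤ Real.exp (G * (s + K * s ^ 2)) := by
        have := Real.add_one_le_exp (G * (s + K * s ^ 2))
        linarith
      refine (pow_le_pow_left₀ h5 h6 n).trans (le_of_eq ?_)
      rw [← Real.exp_nat_mul]
      ring_nf
    rw [Real.exp_sub, le_div_iff₀ (Real.exp_pos y), mul_comm]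
    refine (mul_le_mul_of_nonneg_left h2 (Real.exp_pos y).le).trans ?_
    exact h1.trans (h3.trans h4)
  have htabs : |t| ≤ s₀ := by rwa [abs_of_pos ht0]
  have hupper := hmarkov t ((t - t ^ 2) * ((1 + ε) * (n * G))) htabs
  have hlower := hmarkov (-t) (-(t + t ^ 2) * ((1 - ε) * (n * G))) (by rwa [abs_neg])
  have hcover : {ω | ε * (n * G) ≤ |birkhoffSum T g n ω - n * G|} ⊆
      {ω | (t - t ^ 2) * ((1 + ε) * (n * G)) ≤ (t - t ^ 2) * birkhoffSum T g n ω} ∪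
      {ω | -(t + t ^ 2) * ((1 - ε) * (n * G)) ≤ (-t - (-t) ^ 2) * birkhoffSum T g n ω} := by
    intro ω hω
    rcases le_abs.1 (show ε * (n * G) ≤ |birkhoffSum T g n ω - n * G| from hω) with h | h
    · left
      change (t - t ^ 2) * ((1 + ε) * (n * G)) ≤ (t - t ^ 2) * birkhoffSum T g n ω
      refine mul_le_mul_of_nonneg_left ?_ ?_
      · linarith
      · nlinarith
    · right
      change -(t + t ^ 2) * ((1 - ε) * (n * G)) ≤ (-t - (-t) ^ 2) * birkhoffSum T g n ω
      have : birkhoffSum T g n ω ≤ (1 - ε) * (n * G) := by linarith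
      nlinarith [mul_le_mul_of_nonneg_left this (show 0 ≤ t + t ^ 2 by positivity)]
  have hexp : ∀ z : ℝ, z ≤ -(ε * t / 2) → Real.exp (n * G * z) ≤ Real.exp (-(ε * t / 2 * (n * G))) :=
    fun z hz => Real.exp_le_exp.2 (by nlinarith)
  have hCt : C * t * t ≤ ε / 2 * t := mul_le_mul_of_nonneg_right htC ht0.le
  have h1 := hexp ((t + K * t ^ 2) - (t - t ^ 2) * (1 + ε)) (by rw [hC] at hCt; nlinarith)
  have h2 := hexp ((-t + K * (-t) ^ 2) + (t + t ^ 2) * (1 - ε)) (by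
    rw [hC] at hCt
    nlinarith [mul_pos hε (mul_pos ht0 ht0)])
  have h3 := (measureReal_mono (μ := μ) hcover).trans (measureReal_union_le _ _)
  have e1 : n * G * (t + K * t ^ 2) - (t - t ^ 2) * ((1 + ε) * (n * G)) =
      n * G * ((t + K * t ^ 2) - (t - t ^ 2) * (1 + ε)) := by ring
  have e2 : n * G * (-t + K * (-t) ^ 2) - -(t + t ^ 2) * ((1 - ε) * (n * G)) =
      n * G * ((-t + K * (-t) ^ 2) + (t + t ^ 2) * (1 - ε)) := by ring
  rw [e1] at hupper
  rw [e2] at hlower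
  linarith

end SpectralGapSystem

end Deviation

/-! ### Karamata's theorem and tail estimates -/

/-- The excess of R over the fixed point b/(1 - k) shrinks by the factor k at each dilation by c,
starting from the bound on the fundamental interval [A, cA]. -/
theorem eventually_le_of_dilation_recursion {R : ℝ → ℝ} {c A k b M : ℝ} (hc : 1 < c) (hA : 0 < A)
    (hk0 : 0 ≤ k) (hk1 : k < 1) (hR : ∀ x, A ≤ x → R (c * x) ≤ k * R x + b)
    (hM : ∀ x, A ≤ x → x ≤ c * A → R x ≤ M) {δ : ℝ} (hδ : 0 < δ) :
    ∀ᶠ x in atTop, R x ≤ b / (1 - k) + δ := by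
  have hc0 : 0 < c := by linarith
  have h1k : 0 < 1 - k := by linarith
  set B := b / (1 - k) with hB
  have hBb : k * B + b = B := by rw [hB]; field_simp; ring
  set M' := |M - B| with hM'
  have key : ∀ n : ℕ, ∀ x, A * c ^ n ≤ x → x ≤ A * c ^ (n + 1) → R x ≤ k ^ n * M' + B := by
    intro n
    induction n with
    | zero =>
      intro x h1 h2
      have h3 := hM x (by simpa using h1) (by simpa [mul_comm] using h2)
      have h4 := le_abs_self (M - B)
      rw [pow_zero, one_mul]
      linarith
    | succ n ih =>
      intro x h1 h2
      have h3 : A * c ^ n ≤ x / c := by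
        rw [le_div_iff₀ hc0]
        linarith [show A * c ^ (n + 1) = A * c ^ n * c by ring]
      have h4 : x / c ≤ A * c ^ (n + 1) := by
        rw [div_le_iff₀ hc0]
        linarith [show A * c ^ (n + 1 + 1) = A * c ^ (n + 1) * c by ring]
      have h5 : A ≤ x / c := by
        refine le_trans ?_ h3
        exact le_mul_of_one_le_right hA.le (one_le_pow₀ hc.le)
      have h6 := hR (x / c) h5
      rw [mul_div_cancel₀ _ hc0.ne'] at h6
      have h7 := mul_le_mul_of_nonneg_left (ih _ h3 h4) hk0
      rw [pow_succ]
      linarith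
  have hlim : Tendsto (fun n : ℕ => k ^ n * M') atTop (𝓝 0) := by
    simpa using (tendsto_pow_atTop_nhds_zero_of_lt_one hk0 hk1).mul_const M'
  obtain ⟨n₀, hn₀⟩ := eventually_atTop.1 (hlim.eventually_le_const hδ)
  filter_upwards [eventually_ge_atTop (A * c ^ n₀)] with x hx
  have hx1 : c ^ n₀ ≤ x / A := by rw [le_div_iff₀ hA]; linarith
  obtain ⟨n, h1, h2⟩ := exists_nat_pow_near ((one_le_pow₀ hc.le).trans hx1) hc
  have h3 : n₀ < n + 1 := (pow_lt_pow_iff_right₀ hc).1 (hx1.trans_lt h2)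
  rw [le_div_iff₀ hA] at h1
  rw [div_lt_iff₀ hA] at h2
  have h4 := key n x (by linarith) (by linarith)
  linarith [hn₀ n (by omega)]

/-- In the limit, the lower and upper recursions for m(x)/(x q(x)) under dilation by c have as fixed
points this ratio and c times this ratio. Letting c decrease to 1 closes the gap. -/
theorem tendsto_karamata_ratio {α : ℝ} (hα1 : α < 1) :
    Tendsto (fun c : ℝ => (c ^ α - 1) / (c - c ^ α)) (𝓝[>] 1) (𝓝 (α / (1 - α))) := by
  have h1 : HasDerivAt (fun c : ℝ => c ^ α) α 1 := by
    simpa using Real.hasDerivAt_rpow_const (x := 1) (p := α) (Or.inl one_ne_zero)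
  have h2 : Tendsto (fun c : ℝ => (c - 1)⁻¹ * (c ^ α - 1)) (𝓝[>] 1) (𝓝 α) := by
    have := (hasDerivAt_iff_tendsto_slope.1 h1).mono_left
      (nhdsWithin_mono 1 fun x (hx : x ∈ Set.Ioi 1) => (ne_of_gt hx : x ≠ 1))
    refine this.congr fun c => ?_
    rw [slope_def_field, Real.one_rpow, div_eq_inv_mul]
  have h3 : Tendsto (fun c : ℝ => (c - 1)⁻¹ * (c ^ α - 1) / (1 - (c - 1)⁻¹ * (c ^ α - 1)))
      (𝓝[>] 1) (𝓝 (α / (1 - α))) :=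
    h2.div (h2.const_sub 1) (by linarith)
  refine h3.congr' ?_
  filter_upwards [self_mem_nhdsWithin] with c hc
  have hc' : c - 1 ≠ 0 := sub_ne_zero.2 (ne_of_gt hc)
  have h4 : 1 - (c - 1)⁻¹ * (c ^ α - 1) = (c - 1)⁻¹ * (c - c ^ α) := by
    field_simp
    ring
  rw [h4, mul_div_mul_left _ _ (inv_ne_zero hc')]

/-- `q` behaves like a tail function that is regularly varying of index `-α`, and `m` like the
corresponding truncated mean. -/
structure RegularTail (q m : ℝ → ℝ) (α : ℝ) : Prop where
  pos : ∀ x, 0 < x → 0 < q x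
  le_one : ∀ x, q x ≤ 1
  antitone : Antitone q
  tendsto_ratio : ∀ c, 0 < c → Tendsto (fun x => q (c * x) / q x) atTop (𝓝 (c ^ (-α)))
  mean_nonneg : ∀ x, 0 < x → 0 ≤ m x
  mean_le : ∀ x, 0 < x → m x ≤ x
  mean_mono : ∀ x y, 0 < x → x ≤ y → m x ≤ m y
  le_mean_sub : ∀ x y, 0 < x → x ≤ y → x * (q x - q y) ≤ m y - m x
  mean_sub_le : ∀ x y, 0 < x → x ≤ y → m y - m x ≤ y * (q x - q y)

namespace RegularTail

variable {q m : ℝ → ℝ} {α : ℝ}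

theorem tendsto_div_dilation (h : RegularTail q m α) {c : ℝ} (hc : 0 < c) :
    Tendsto (fun x => q x / q (c * x)) atTop (𝓝 (c ^ α)) := by
  have h1 := (h.tendsto_ratio c hc).inv₀ (Real.rpow_pos_of_pos hc _).ne'
  rw [← Real.rpow_neg hc.le, neg_neg] at h1
  exact h1.congr fun x => inv_div _ _

theorem mean_div_dilation_le (h : RegularTail q m α) {c x : ℝ} (hc : 1 < c) (hx : 0 < x) :
    m (c * x) / (c * x * q (c * x)) ≤
      (q x / q (c * x)) / c * (m x / (x * q x)) + (q x / q (c * x) - 1) := by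
  have hc0 : 0 < c := by linarith
  have hq := h.pos x hx
  have hqc := h.pos (c * x) (by positivity)
  have h1 := h.mean_sub_le x (c * x) hx (le_mul_of_one_le_left hx.le hc.le)
  rw [div_le_iff₀ (by positivity)]
  have h2 : ((q x / q (c * x)) / c * (m x / (x * q x)) + (q x / q (c * x) - 1)) *
      (c * x * q (c * x)) = m x + c * x * (q x - q (c * x)) := by
    field_simp
  rw [h2]
  linarith

theorem le_mean_div_dilation (h : RegularTail q m α) {c x : ℝ} (hc : 1 < c) (hx : 0 < x) :
    (q x / q (c * x)) / c * (m x / (x * q x)) + (q x / q (c * x) - 1) / c ≤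
      m (c * x) / (c * x * q (c * x)) := by
  have hc0 : 0 < c := by linarith
  have hq := h.pos x hx
  have hqc := h.pos (c * x) (by positivity)
  have h1 := h.le_mean_sub x (c * x) hx (le_mul_of_one_le_left hx.le hc.le)
  rw [le_div_iff₀ (by positivity)]
  have h2 : ((q x / q (c * x)) / c * (m x / (x * q x)) + (q x / q (c * x) - 1) / c) *
      (c * x * q (c * x)) = m x + x * (q x - q (c * x)) := by
    field_simp
  rw [h2]
  linarith

/-- Karamata's theorem for the truncated mean. -/
theorem tendsto_mean_div (h : RegularTail q m α) (hα0 : 0 < α) (hα1 : α < 1) :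
    Tendsto (fun x => m x / (x * q x)) atTop (𝓝 (α / (1 - α))) := by
  set R : ℝ → ℝ := fun x => m x / (x * q x) with hR
  have hR0 : ∀ x, 0 < x → 0 ≤ R x := fun x hx => by
    have := h.mean_nonneg x hx
    have := h.pos x hx
    positivity
  have hid : Tendsto (fun c : ℝ => c) (𝓝[>] 1) (𝓝 1) := tendsto_nhdsWithin_of_tendsto_nhds tendsto_id
  rw [tendsto_order]
  constructor
  · intro l hl
    obtain ⟨l', hl', hl''⟩ := exists_between hl
    obtain ⟨c, hc1, hc⟩ := (((tendsto_karamata_ratio hα1).eventually_const_lt hl'').and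
      self_mem_nhdsWithin).exists
    have hc : 1 < c := hc
    have hc0 : 0 < c := by linarith
    have hca : c ^ α < c := by
      simpa using Real.rpow_lt_rpow_of_exponent_lt hc hα1
    -- The ratio q x / q (c x) only tends to c^α, so it is replaced by some w slightly below c^α,
    -- which it eventually exceeds. The upper bound uses w slightly above.
    have hca0 : 1 < c ^ α := Real.one_lt_rpow hc hα0
    have hw : Tendsto (fun w : ℝ => (w - 1) / (c - w)) (𝓝[<] (c ^ α))
        (𝓝 ((c ^ α - 1) / (c - c ^ α))) := by
      apply tendsto_nhdsWithin_of_tendsto_nhds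
      exact ((tendsto_id.sub_const 1).div (tendsto_id.const_sub c) (by simpa using by linarith))
    obtain ⟨w, ⟨hw1, hw2⟩, hw3⟩ := (((hw.eventually_const_lt hc1).and
      (Ioo_mem_nhdsLT hca0)).and self_mem_nhdsWithin).exists
    have hw3 : w < c ^ α := hw3
    have hwc : 0 < c - w := by linarith
    obtain ⟨A, hA⟩ := eventually_atTop.1
      ((h.tendsto_div_dilation hc0).eventually_const_le hw3)
    have hrec := eventually_le_of_dilation_recursion (R := fun x => -R x) (c := c)
      (A := max A 1) (k := w / c) (b := -((w - 1) / c)) (M := 0) hc (by positivity)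
      (by have := hw2.1; positivity) (by rw [div_lt_one hc0]; linarith) ?_ ?_
      (sub_pos.2 hl')
    · filter_upwards [hrec] with x hx
      have e : -((w - 1) / c) / (1 - w / c) = -((w - 1) / (c - w)) := by
        field_simp
      rw [e] at hx
      linarith
    · intro x hx
      have hx0 : 0 < x := lt_of_lt_of_le (by positivity) hx
      have h1 := h.le_mean_div_dilation hc hx0
      have h2 := hA x ((le_max_left _ _).trans hx)
      have h3 := hR0 x hx0
      have h4 : w / c * R x + (w - 1) / c ≤
          (q x / q (c * x)) / c * (m x / (x * q x)) + (q x / q (c * x) - 1) / c := by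
        gcongr
      have h5 : R (c * x) = m (c * x) / (c * x * q (c * x)) := rfl
      change -R (c * x) ≤ w / c * -R x + -((w - 1) / c)
      rw [h5]
      linarith
    · intro x hx _
      have := hR0 x (lt_of_lt_of_le (by positivity) hx)
      linarith
  · intro l hl
    obtain ⟨l', hl', hl''⟩ := exists_between hl
    have hlim : Tendsto (fun c : ℝ => c * ((c ^ α - 1) / (c - c ^ α))) (𝓝[>] 1)
        (𝓝 (α / (1 - α))) := by
      simpa using hid.mul (tendsto_karamata_ratio hα1)
    obtain ⟨c, hc1, hc⟩ := ((hlim.eventually_lt_const hl').and self_mem_nhdsWithin).exists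
    have hc : 1 < c := hc
    have hc0 : 0 < c := by linarith
    have hca : c ^ α < c := by
      simpa using Real.rpow_lt_rpow_of_exponent_lt hc hα1
    have hca0 : 1 < c ^ α := Real.one_lt_rpow hc hα0
    have hw : Tendsto (fun w : ℝ => c * ((w - 1) / (c - w))) (𝓝[>] (c ^ α))
        (𝓝 (c * ((c ^ α - 1) / (c - c ^ α)))) := by
      apply tendsto_nhdsWithin_of_tendsto_nhds
      exact ((tendsto_id.sub_const 1).div (tendsto_id.const_sub c)
        (by simpa using by linarith)).const_mul c
    obtain ⟨w, ⟨hw1, hw2⟩, hw3⟩ := (((hw.eventually_lt_const hc1).and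
      (Ioo_mem_nhdsGT hca)).and self_mem_nhdsWithin).exists
    have hw3 : c ^ α < w := hw3
    have hwc : 0 < c - w := by linarith [hw2.2]
    obtain ⟨A, hA⟩ := eventually_atTop.1
      ((h.tendsto_div_dilation hc0).eventually_le_const hw3)
    have hrec := eventually_le_of_dilation_recursion (R := R) (c := c)
      (A := max A 1) (k := w / c) (b := w - 1) (M := 1 / q (c * max A 1)) hc (by positivity)
      (div_nonneg (by linarith) hc0.le) (by rw [div_lt_one hc0]; linarith) ?_ ?_
      (sub_pos.2 hl'')
    · filter_upwards [hrec, eventually_gt_atTop (0 : ℝ)] with x hx hx0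
      have e : (w - 1) / (1 - w / c) = c * ((w - 1) / (c - w)) := by
        field_simp
      rw [e] at hx
      linarith
    · intro x hx
      have hx0 : 0 < x := lt_of_lt_of_le (by positivity) hx
      have h1 := h.mean_div_dilation_le hc hx0
      have h2 := hA x ((le_max_left _ _).trans hx)
      have h3 := hR0 x hx0
      have h4 : (q x / q (c * x)) / c * (m x / (x * q x)) + (q x / q (c * x) - 1) ≤
          w / c * R x + (w - 1) := by
        gcongr
      exact h1.trans h4
    · intro x hx hx1
      have hx0 : 0 < x := lt_of_lt_of_le (by positivity) hx
      have hq := h.pos _ (hx0.trans_le hx1)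
      have hq' := h.antitone hx1
      have hqx := h.pos x hx0
      rw [hR]
      change m x / (x * q x) ≤ _
      rw [div_le_div_iff₀ (by positivity) hq]
      have := h.mean_le x hx0
      nlinarith [h.mean_nonneg x hx0]

/-- A monotone q with nonzero limit would have q(2x)/q(x) → 1, contradicting 2^(-α) < 1. -/
theorem tendsto_zero (h : RegularTail q m α) (hα0 : 0 < α) : Tendsto q atTop (𝓝 0) := by
  have hq0 : ∀ x, 0 ≤ q x := fun x =>
    (h.pos _ (lt_max_of_lt_right one_pos)).le.trans (h.antitone (le_max_left x 1))
  have hl := tendsto_atTop_ciInf h.antitone ⟨0, by rintro _ ⟨x, rfl⟩; exact hq0 x⟩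
  set l := ⨅ x, q x
  have hl2 : Tendsto (fun x => q (2 * x)) atTop (𝓝 l) :=
    hl.comp (tendsto_id.const_mul_atTop two_pos)
  by_cases hl0 : l = 0
  · rwa [hl0] at hl
  · exfalso
    have h1 := hl2.div hl hl0
    rw [div_self hl0] at h1
    have h2 := tendsto_nhds_unique h1 (h.tendsto_ratio 2 two_pos)
    have h3 : (2 : ℝ) ^ (-α) < 1 := Real.rpow_lt_one_of_one_lt_of_neg one_lt_two (by linarith)
    linarith

theorem mean_pos (h : RegularTail q m α) {a : ℝ} (ha : 0 < a) (hma : 0 < m a) {x : ℝ}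
    (hx : a ≤ x) : 0 < m x := hma.trans_le (h.mean_mono a x ha hx)

/-- Karamata's theorem gives the comparison for large x; monotonicity covers the remaining bounded
range of levels. The same holds for the reverse bound below. -/
theorem exists_le_mean_div (h : RegularTail q m α) (hα0 : 0 < α) (hα1 : α < 1) {a : ℝ}
    (ha : 0 < a) (hma : 0 < m a) : ∃ k, 0 < k ∧ ∀ x, a ≤ x → k * q x ≤ m x / x := by
  have h1 : 0 < α / (1 - α) := div_pos hα0 (by linarith)
  obtain ⟨A, hA⟩ := eventually_atTop.1
    ((h.tendsto_mean_div hα0 hα1).eventually_const_le (half_lt_self h1))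
  set A' := max A a
  have hA' : 0 < A' := ha.trans_le (le_max_right _ _)
  refine ⟨min (α / (1 - α) / 2) (m a / A'), lt_min (by positivity) (by positivity), ?_⟩
  intro x hx
  have hx0 := ha.trans_le hx
  have hq := h.pos x hx0
  rcases le_total A' x with hxA | hxA
  · have h2 := hA x ((le_max_left _ _).trans hxA)
    rw [le_div_iff₀ (by positivity)] at h2
    rw [le_div_iff₀ hx0]
    refine le_trans ?_ h2
    rw [mul_assoc, mul_comm (q x)]
    gcongr
    exact min_le_left _ _
  · calc min (α / (1 - α) / 2) (m a / A') * q x ≤ (m a / A') * 1 := by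
          gcongr
          · exact min_le_right _ _
          · exact h.le_one x
      _ ≤ m x / x := by
          rw [mul_one]
          have := h.mean_mono a x ha hx
          gcongr
          exact h.mean_nonneg x hx0

theorem exists_mean_le (h : RegularTail q m α) (hα0 : 0 < α) (hα1 : α < 1) {a : ℝ}
    (ha : 0 < a) : ∃ k, 0 < k ∧ ∀ x, a ≤ x → m x ≤ k * (x * q x) := by
  obtain ⟨A, hA⟩ := eventually_atTop.1
    ((h.tendsto_mean_div hα0 hα1).eventually_le_const (lt_add_one _))
  set A' := max A a
  have hA' : 0 < A' := ha.trans_le (le_max_right _ _)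
  have hqA := h.pos A' hA'
  refine ⟨max (α / (1 - α) + 1) (1 / q A'), lt_max_of_lt_right (by positivity), ?_⟩
  intro x hx
  have hx0 := ha.trans_le hx
  have hq := h.pos x hx0
  rcases le_total A' x with hxA | hxA
  · have h2 := hA x ((le_max_left _ _).trans hxA)
    rw [div_le_iff₀ (by positivity)] at h2
    refine h2.trans ?_
    gcongr
    exact le_max_left _ _
  · calc m x ≤ x := h.mean_le x hx0
      _ ≤ 1 / q A' * (x * q x) := by
          rw [div_mul_eq_mul_div, one_mul, le_div_iff₀ hqA]
          have := h.antitone hxA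
          gcongr
      _ ≤ _ := by
          gcongr
          exact le_max_right _ _

theorem exists_halving (h : RegularTail q m α) (hα0 : 0 < α) {a : ℝ} (ha : 0 < a) :
    ∃ B, 1 < B ∧ ∀ x, a ≤ x → q (B * x) ≤ q x / 2 := by
  obtain ⟨B₀, hB₀, hB₀1⟩ : ∃ B : ℝ, 1 < B ∧ B ^ (-α) < 1 / 2 :=
    ((eventually_gt_atTop 1).and ((tendsto_rpow_neg_atTop hα0).eventually_lt_const
      (by norm_num : (0 : ℝ) < 1 / 2))).exists
  obtain ⟨A, hA⟩ := eventually_atTop.1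
    ((h.tendsto_ratio B₀ (by linarith)).eventually_le_const hB₀1)
  set A' := max A a
  have hA' : 0 < A' := ha.trans_le (le_max_right _ _)
  have hqA := h.pos A' hA'
  obtain ⟨B₁, hB₁⟩ := eventually_atTop.1 ((h.tendsto_zero hα0).eventually_le_const (half_pos hqA))
  refine ⟨max B₀ (B₁ / a), lt_max_of_lt_left hB₀, ?_⟩
  intro x hx
  have hx0 := ha.trans_le hx
  rcases le_total A' x with hxA | hxA
  · have h1 := hA x ((le_max_left _ _).trans hxA)
    rw [div_le_iff₀ (h.pos x hx0)] at h1
    have h2 : q (max B₀ (B₁ / a) * x) ≤ q (B₀ * x) :=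
      h.antitone (mul_le_mul_of_nonneg_right (le_max_left _ _) hx0.le)
    linarith
  · have h1 := h.antitone hxA
    have hB1 : B₁ ≤ max B₀ (B₁ / a) * x := by
      have h3 : B₁ = B₁ / a * a := by field_simp
      calc B₁ = B₁ / a * a := h3
        _ ≤ max B₀ (B₁ / a) * a := mul_le_mul_of_nonneg_right (le_max_right _ _) ha.le
        _ ≤ max B₀ (B₁ / a) * x :=
            mul_le_mul_of_nonneg_left hx (by linarith [le_max_left B₀ (B₁ / a)])
    have h2 := hB₁ _ hB1
    linarith

/-- The truncated mean grows at most exponentially in the inverse of the tail. -/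
theorem exists_log_mean_div_le (h : RegularTail q m α) (hα0 : 0 < α) (hα1 : α < 1) {a : ℝ}
    (ha : 0 < a) (hma : 0 < m a) :
    ∃ H, 0 < H ∧ ∀ x y, a ≤ x → x ≤ y → Real.log (m y / m x) ≤ H * (q x / q y) := by
  obtain ⟨k₁, hk₁, h₁⟩ := h.exists_le_mean_div hα0 hα1 ha hma
  obtain ⟨k₂, hk₂, h₂⟩ := h.exists_mean_le hα0 hα1 ha
  obtain ⟨B, hB, hB'⟩ := h.exists_halving hα0 ha
  have hB0 : 0 < B := by linarith
  have hlogB := Real.log_pos hB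
  refine ⟨|Real.log (k₂ / k₁)| + Real.log B, by positivity, ?_⟩
  intro x y hx hxy
  have hx0 := ha.trans_le hx
  have hy0 := hx0.trans_le hxy
  have hqx := h.pos x hx0
  have hqy := h.pos y hy0
  have hmx := h.mean_pos ha hma hx
  have hmy := h.mean_pos ha hma (hx.trans hxy)
  have hq1 : 1 ≤ q x / q y := by
    rw [one_le_div hqy]
    exact h.antitone hxy
  have hpow : ∀ n : ℕ, q (B ^ n * x) ≤ q x / 2 ^ n := by
    intro n
    induction n with
    | zero => simp
    | succ n ih =>
      have h3 := hB' (B ^ n * x) (hx.trans (le_mul_of_one_le_left hx0.le (one_le_pow₀ hB.le)))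
      rw [pow_succ', mul_assoc]
      refine h3.trans ?_
      rw [pow_succ, ← div_div]
      gcongr
  -- If y/x lies between Bⁿ and Bⁿ⁺¹, halving gives q x / q y ≥ 2ⁿ ≥ n + 1, while log(y/x) ≤ (n + 1)
  -- log B.
  have hyx : Real.log (y / x) ≤ Real.log B * (q x / q y) := by
    obtain ⟨n, hn1, hn2⟩ := exists_nat_pow_near ((one_le_div hx0).2 hxy) hB
    rw [le_div_iff₀ hx0] at hn1
    have h3 : (2 : ℝ) ^ n ≤ q x / q y := by
      rw [le_div_iff₀ hqy]
      have := (h.antitone hn1).trans (hpow n)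
      rw [le_div_iff₀ (by positivity)] at this
      linarith
    have h4 : Real.log (y / x) ≤ (n + 1 : ℕ) * Real.log B := by
      rw [← Real.log_pow]
      exact Real.log_le_log (by positivity) hn2.le
    have h5 : ((n + 1 : ℕ) : ℝ) ≤ 2 ^ n := by
      exact_mod_cast Nat.lt_two_pow_self
    rw [mul_comm]
    exact h4.trans (mul_le_mul_of_nonneg_right (h5.trans h3) hlogB.le)
  have hm : m y / m x ≤ k₂ / k₁ * (y / x) := by
    have h3 := h₁ x hx
    rw [le_div_iff₀ hx0] at h3
    have h4 := h₂ y (hx.trans hxy)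
    calc m y / m x ≤ (k₂ * (y * q y)) / (k₁ * q x * x) := by gcongr
      _ = k₂ / k₁ * (y / x) * (q y / q x) := by field_simp
      _ ≤ k₂ / k₁ * (y / x) * 1 := by
          gcongr
          rw [div_le_one hqx]
          exact h.antitone hxy
      _ = _ := mul_one _
  have h5 := Real.log_le_log (by positivity) hm
  rw [Real.log_mul (by positivity) (by positivity)] at h5
  have h6 := le_abs_self (Real.log (k₂ / k₁))
  have h7 := abs_nonneg (Real.log (k₂ / k₁))
  nlinarith

end RegularTail

/-! ### Simultaneous bound over a block of times -/

/-- Deviation bounds for single members of a family of functions that is monotone in both parameters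
give a simultaneous bound over a block of comparable times. -/
theorem exists_measure_block_le {Ω : Type*} [MeasurableSpace Ω] {μ : Measure Ω}
    [IsProbabilityMeasure μ] {S : ℕ → ℝ → Ω → ℝ} {q m : ℝ → ℝ}
    (hSn : ∀ n n' x ω, n ≤ n' → S n x ω ≤ S n' x ω) (hSx : ∀ n x y ω, x ≤ y → S n x ω ≤ S n y ω)
    (hq : Antitone q) {a k H δ c : ℝ} (hk : 0 < k) (hH : 0 < H) (hδ : 0 < δ) (hδ1 : δ ≤ 1)
    (hc : 0 < c) (hq0 : ∀ x, a ≤ x → 0 < q x) (hm0 : ∀ x, a ≤ x → 0 < m x)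
    (hmm : ∀ x y, a ≤ x → x ≤ y → m x ≤ m y)
    (hkq : ∀ x, a ≤ x → k * q x ≤ m x / x)
    (hlog : ∀ x y, a ≤ x → x ≤ y → Real.log (m y / m x) ≤ H * (q x / q y))
    (hdev : ∀ x, a ≤ x → ∀ n : ℕ, μ.real {ω | δ * (n * m x) ≤ |S n x ω - n * m x|} ≤
      2 * Real.exp (-(c * (n * (m x / x))))) :
    ∃ c', 0 < c' ∧ ∀ (D : Finset ℕ) (f : ℕ → ℝ) (Y : ℝ),
      (∀ n ∈ D, ∀ n' ∈ D, (n' : ℝ) ≤ Real.exp δ * n) → (∀ n ∈ D, a ≤ f n) →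
      (∀ n ∈ D, Y ≤ n * q (f n)) → Real.exp (-(c' * Y)) ≤ 1 / 2 →
      μ.real (⋃ n ∈ D, {ω | ¬((1 - δ) * Real.exp (-(2 * δ)) * (n * m (f n)) ≤ S n (f n) ω ∧
        S n (f n) ω ≤ (1 + δ) * Real.exp (2 * δ) * (n * m (f n)))}) ≤
      8 * Real.exp (-(c' * Y)) := by
  -- Averaging q(f n) ≥ q V with q(f n) ≥ lev n · (δ/H) · q V gives the factor θ (lev n + 1) of
  -- `hqlev`.
  set θ := min 1 (δ / H) / 2 with hθ
  have hθ0 : 0 < θ := by positivity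
  refine ⟨c * k * Real.exp (-δ) * θ, by positivity, ?_⟩
  intro D f Y hD hfa hY hr
  set r := Real.exp (-(c * k * Real.exp (-δ) * θ * Y)) with hr_def
  have hr0 : 0 < r := Real.exp_pos _
  have hY0 : 0 ≤ Y := by
    by_contra! hneg
    have h1 : 0 ≤ -(c * k * Real.exp (-δ) * θ * Y) := by
      have : 0 < c * k * Real.exp (-δ) * θ := by positivity
      nlinarith
    have := Real.one_le_exp h1
    linarith
  rcases D.eq_empty_or_nonempty with rfl | hDne
  · simp only [Finset.notMem_empty, Set.iUnion_of_empty, Set.iUnion_empty, measureReal_empty]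
    positivity
  obtain ⟨n₀, hn₀, hn₀max⟩ := D.exists_max_image f hDne
  set V := f n₀ with hV
  have hVa : a ≤ V := hfa n₀ hn₀
  have hmV := hm0 V hVa
  have hqV := hq0 V hVa
  -- Classes of means relative to the largest level V: within one class the means agree up to a
  -- factor exp δ.
  set lev : ℕ → ℕ := fun n => ⌊Real.log (m V / m (f n)) / δ⌋₊ with hlev
  have hlev_le : ∀ n ∈ D, lev n * δ ≤ Real.log (m V / m (f n)) := by
    intro n hn
    rw [← le_div_iff₀ hδ]
    apply Nat.floor_le
    apply div_nonneg _ hδ.le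
    apply Real.log_nonneg
    rw [one_le_div (hm0 _ (hfa n hn))]
    exact hmm _ _ (hfa n hn) (hn₀max n hn)
  have hlev_lt : ∀ n, Real.log (m V / m (f n)) < (lev n + 1) * δ := by
    intro n
    rw [← div_lt_iff₀ hδ]
    exact Nat.lt_floor_add_one _
  have hlev_eq : ∀ n ∈ D, ∀ n' ∈ D, lev n = lev n' → m (f n') ≤ Real.exp δ * m (f n) := by
    intro n hn n' hn' h
    have h1 := hlev_lt n
    have h2 := hlev_le n' hn'
    have hmn := hm0 _ (hfa n hn)
    have hmn' := hm0 _ (hfa n' hn')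
    rw [Real.log_div hmV.ne' hmn.ne'] at h1
    rw [Real.log_div hmV.ne' hmn'.ne', ← h] at h2
    have h3 : Real.log (m (f n')) ≤ δ + Real.log (m (f n)) := by linarith
    rw [← Real.exp_le_exp, Real.exp_add, Real.exp_log hmn, Real.exp_log hmn'] at h3
    exact h3
  have hqlev : ∀ n ∈ D, q V * (θ * (lev n + 1)) ≤ q (f n) := by
    intro n hn
    have h1 := (hlev_le n hn).trans (hlog (f n) V (hfa n hn) (hn₀max n hn))
    have h2 := hq (hn₀max n hn)
    have h3 : lev n * (δ / H) * q V ≤ q (f n) := by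
      rw [← mul_div_assoc, div_mul_eq_mul_div, div_le_iff₀ hH]
      rw [← mul_div_assoc, le_div_iff₀ hqV] at h1
      linarith
    have h4 : θ ≤ 1 / 2 := by rw [hθ]; gcongr; exact min_le_left _ _
    have h5 : θ ≤ δ / H / 2 := by rw [hθ]; gcongr; exact min_le_right _ _
    have h6 : (lev n : ℝ) * θ ≤ lev n * (δ / H / 2) := by gcongr
    nlinarith
  have hprob : ∀ N ∈ D, ∀ n ∈ D,
      μ.real {ω | δ * (N * m (f n)) ≤ |S N (f n) ω - N * m (f n)|} ≤ 2 * r ^ (lev n + 1) := by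
    intro N hN n hn
    refine (hdev (f n) (hfa n hn) N).trans ?_
    rw [hr_def, ← Real.exp_nat_mul]
    gcongr
    push_cast
    have h1 := hY n₀ hn₀
    have h2 := hD N hN n₀ hn₀
    have h3 : Real.exp (-δ) * Y ≤ N * q V := by
      rw [Real.exp_neg, inv_mul_le_iff₀ (Real.exp_pos δ)]
      have := mul_le_mul_of_nonneg_right h2 hqV.le
      linarith
    have h4 : N * (k * (q V * (θ * (lev n + 1)))) ≤ N * (m (f n) / f n) := by
      refine mul_le_mul_of_nonneg_left ?_ (Nat.cast_nonneg N)
      exact (mul_le_mul_of_nonneg_left (hqlev n hn) hk.le).trans (hkq _ (hfa n hn))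
    have h5 : Real.exp (-δ) * Y * (k * (θ * (lev n + 1))) ≤
        N * q V * (k * (θ * (lev n + 1))) := by gcongr
    nlinarith
  have hcover : ∀ p : ℕ, ∃ E : Set Ω, μ.real E ≤ 4 * r ^ (p + 1) ∧
      ∀ n ∈ D, lev n = p → {ω | ¬((1 - δ) * Real.exp (-(2 * δ)) * (n * m (f n)) ≤ S n (f n) ω ∧
        S n (f n) ω ≤ (1 + δ) * Real.exp (2 * δ) * (n * m (f n)))} ⊆ E := by
    intro p
    set X := D.filter fun n => lev n = p with hX
    rcases X.eq_empty_or_nonempty with hXe | hXne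
    · refine ⟨∅, by rw [measureReal_empty]; positivity, ?_⟩
      intro n hn hp
      have : n ∈ X := Finset.mem_filter.2 ⟨hn, hp⟩
      rw [hXe] at this
      exact absurd this (Finset.notMem_empty n)
    obtain ⟨N, hN, hNmin⟩ := X.exists_min_image id hXne
    obtain ⟨N', hN', hNmax⟩ := X.exists_max_image id hXne
    obtain ⟨u, hu, humin⟩ := X.exists_min_image f hXne
    obtain ⟨v, hv, hvmax⟩ := X.exists_max_image f hXne
    simp only [hX, Finset.mem_filter, id] at hN hN' hu hv hNmin hNmax humin hvmax
    -- The corners pair the least time with the least level and the greatest with the greatest; they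
    -- need not come from one n. One factor exp δ is lost in time and one in the mean.
    refine ⟨{ω | δ * (N * m (f u)) ≤ |S N (f u) ω - N * m (f u)|} ∪
      {ω | δ * (N' * m (f v)) ≤ |S N' (f v) ω - N' * m (f v)|}, ?_, ?_⟩
    · have h1 := hprob N hN.1 u hu.1
      have h2 := hprob N' hN'.1 v hv.1
      rw [hu.2] at h1
      rw [hv.2] at h2
      have h3 := measureReal_union_le (μ := μ)
        {ω | δ * (N * m (f u)) ≤ |S N (f u) ω - N * m (f u)|}
        {ω | δ * (N' * m (f v)) ≤ |S N' (f v) ω - N' * m (f v)|}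
      linarith
    · intro n hn hp ω hω
      by_contra hgood
      simp only [Set.mem_union, Set.mem_ofPred_eq, not_or, not_le] at hgood
      obtain ⟨h1, h2⟩ := hgood
      have h1 := (abs_lt.1 h1).1
      have h2 := (abs_lt.1 h2).2
      apply hω
      have hexp : Real.exp (2 * δ) = Real.exp δ * Real.exp δ := by rw [← Real.exp_add]; ring_nf
      have hmn := hm0 _ (hfa n hn)
      have hmu := hm0 _ (hfa u hu.1)
      have hmv := hm0 _ (hfa v hv.1)
      constructor
      · have h3 : S N (f u) ω ≤ S n (f n) ω :=
          (hSn _ _ _ _ (hNmin n ⟨hn, hp⟩)).trans (hSx _ _ _ _ (humin n ⟨hn, hp⟩))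
        have h4 : (n : ℝ) * m (f n) ≤ Real.exp (2 * δ) * (N * m (f u)) := by
          have := mul_le_mul (hD N hN.1 n hn) (hlev_eq u hu.1 n hn (hu.2.trans hp.symm)) hmn.le
            (by positivity)
          rw [hexp]
          linarith
        have h5 : Real.exp (-(2 * δ)) * (n * m (f n)) ≤ N * m (f u) := by
          rw [Real.exp_neg, inv_mul_le_iff₀ (Real.exp_pos _)]
          exact h4
        have h6 := mul_le_mul_of_nonneg_left h5 (sub_nonneg.2 hδ1)
        linarith
      · have h3 : S n (f n) ω ≤ S N' (f v) ω :=
          (hSn _ _ _ _ (hNmax n ⟨hn, hp⟩)).trans (hSx _ _ _ _ (hvmax n ⟨hn, hp⟩))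
        have h4 : (N' : ℝ) * m (f v) ≤ Real.exp (2 * δ) * (n * m (f n)) := by
          have := mul_le_mul (hD n hn N' hN'.1) (hlev_eq n hn v hv.1 (hp.trans hv.2.symm)) hmv.le
            (by positivity)
          rw [hexp]
          linarith
        have h6 := mul_le_mul_of_nonneg_left h4 (by linarith : 0 ≤ 1 + δ)
        linarith
  choose E hE hE' using hcover
  have hsub : (⋃ n ∈ D, {ω | ¬((1 - δ) * Real.exp (-(2 * δ)) * (n * m (f n)) ≤ S n (f n) ω ∧
      S n (f n) ω ≤ (1 + δ) * Real.exp (2 * δ) * (n * m (f n)))}) ⊆ ⋃ p ∈ D.image lev, E p := by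
    intro ω hω
    simp only [Set.mem_iUnion] at hω ⊢
    obtain ⟨n, hn, hω⟩ := hω
    exact ⟨lev n, Finset.mem_image_of_mem _ hn, hE' _ n hn rfl hω⟩
  refine (measureReal_mono hsub (measure_ne_top μ _)).trans ((measureReal_biUnion_finset_le _ _).trans ?_)
  refine (Finset.sum_le_sum fun p _ => hE p).trans ?_
  have hr1 : r < 1 := by linarith
  have hsum : Summable fun p : ℕ => 4 * r ^ (p + 1) :=
    ((summable_nat_add_iff 1).2 (summable_geometric_of_lt_one hr0.le hr1)).mul_left 4
  refine (hsum.sum_le_tsum _ fun p _ => by positivity).trans ?_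
  have h1 : ∀ p : ℕ, 4 * r ^ (p + 1) = 4 * r * r ^ p := fun p => by ring
  simp only [h1]
  rw [tsum_mul_left, tsum_geometric_of_lt_one hr0.le hr1]
  have h2 : (1 - r)⁻¹ ≤ 2 := by
    rw [inv_le_comm₀ (by linarith) two_pos]
    linarith
  nlinarith

/-- Natural division by r takes each value r times. This passes from unit intervals of log n to
blocks of length 1/r. -/
theorem summable_comp_div {g : ℕ → ℝ} (hg : Summable g) (hg0 : ∀ n, 0 ≤ g n) {r : ℕ}
    (hr : 0 < r) : Summable fun i : ℕ => g (i / r) := by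
  have : NeZero r := ⟨hr.ne'⟩
  have h1 : Summable fun x : ℕ × Fin r => g x.1 * 1 :=
    hg.mul_of_nonneg (g := fun _ : Fin r => (1 : ℝ)) (Summable.of_finite) hg0 fun _ => zero_le_one
  have h2 := (Nat.divModEquiv r).summable_iff.2 h1
  refine h2.congr fun i => ?_
  simp [Nat.divModEquiv]

/-! ### The truncated observable -/

section Observable

variable {Ω : Type*} {χ : Ω → ℝ}

theorem trunc_nonneg (hχ : ∀ ω, 0 ≤ χ ω) (x : ℝ) (ω : Ω) : 0 ≤ trunc χ x ω :=
  Set.indicator_nonneg (fun ω _ => hχ ω) ω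

theorem trunc_le {x : ℝ} (hx : 0 ≤ x) (ω : Ω) : trunc χ x ω ≤ x :=
  Set.indicator_le' (fun _ h => h) (fun _ _ => hx) ω

theorem trunc_mono (hχ : ∀ ω, 0 ≤ χ ω) {x y : ℝ} (hxy : x ≤ y) (ω : Ω) :
    trunc χ x ω ≤ trunc χ y ω :=
  Set.indicator_le_indicator_of_subset (fun _ (h : χ _ ≤ x) => h.trans hxy) hχ ω

theorem truncSum_mono_left {T : Ω → Ω} (hχ : ∀ ω, 0 ≤ χ ω) {n n' : ℕ} (h : n ≤ n') (x : ℝ) (ω : Ω) :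
    truncSum T χ x n ω ≤ truncSum T χ x n' ω :=
  Finset.sum_le_sum_of_subset_of_nonneg (Finset.range_mono h) fun _ _ _ => trunc_nonneg hχ _ _

theorem truncSum_mono_right {T : Ω → Ω} (hχ : ∀ ω, 0 ≤ χ ω) (n : ℕ) {x y : ℝ} (h : x ≤ y) (ω : Ω) :
    truncSum T χ x n ω ≤ truncSum T χ y n ω := by
  unfold truncSum birkhoffSum
  exact Finset.sum_le_sum fun _ _ => trunc_mono hχ h _

variable [MeasurableSpace Ω] {T : Ω → Ω} {μ : Measure Ω}

theorem measurable_trunc (hχ : Measurable χ) (x : ℝ) : Measurable (trunc χ x) :=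
  hχ.indicator (measurableSet_le hχ measurable_const)

theorem integrable_trunc [IsProbabilityMeasure μ] (hχm : Measurable χ) (hχ : ∀ ω, 0 ≤ χ ω) {x : ℝ}
    (hx : 0 ≤ x) : Integrable (trunc χ x) μ := by
  refine Integrable.of_bound (measurable_trunc hχm x).aestronglyMeasurable x
    (ae_of_all _ fun ω => ?_)
  rw [Real.norm_eq_abs, abs_of_nonneg (trunc_nonneg hχ x ω)]
  exact trunc_le hx ω

theorem integral_truncSum [IsProbabilityMeasure μ] (hT : MeasurePreserving T μ μ)
    (hχm : Measurable χ) (hχ : ∀ ω, 0 ≤ χ ω) {x : ℝ} (hx : 0 ≤ x) (n : ℕ) :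
    ∫ ω, truncSum T χ x n ω ∂μ = n * ∫ ω, trunc χ x ω ∂μ := by
  have hk : ∀ k, ∫ ω, trunc χ x (T^[k] ω) ∂μ = ∫ ω, trunc χ x ω ∂μ := by
    intro k
    have h1 := (hT.iterate k).map_eq
    conv_rhs => rw [← h1]
    rw [integral_map (hT.iterate k).measurable.aemeasurable
      (measurable_trunc hχm x).aestronglyMeasurable]
  simp only [truncSum, birkhoffSum]
  rw [integral_finsetSum]
  · simp [hk]
  · intro k _
    exact (hT.iterate k).integrable_comp_of_integrable (integrable_trunc hχm hχ hx)

theorem measureReal_between [IsProbabilityMeasure μ] (hχm : Measurable χ) {x y : ℝ}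
    (hxy : x ≤ y) : μ.real {ω | x < χ ω ∧ χ ω ≤ y} = μ.real {ω | x < χ ω} - μ.real {ω | y < χ ω} := by
  have hsub : {ω | y < χ ω} ⊆ {ω | x < χ ω} := fun ω (h : y < χ ω) => lt_of_le_of_lt hxy h
  rw [← measureReal_sdiff hsub (measurableSet_lt measurable_const hχm)]
  congr 1 with ω
  simp

theorem regularTail [IsProbabilityMeasure μ] (hχm : Measurable χ) (hχ : ∀ ω, 0 ≤ χ ω)
    {α : ℝ} {L : ℝ → ℝ} (hL : SlowlyVarying L)
    (htail : ∀ x : ℝ, 0 < x → μ.real {ω | x < χ ω} = L x / x ^ α) :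
    RegularTail (fun x => μ.real {ω | x < χ ω}) (fun x => ∫ ω, trunc χ x ω ∂μ) α := by
  have hanti : Antitone fun x => μ.real {ω | x < χ ω} := fun x y hxy =>
    measureReal_mono fun ω (h : y < χ ω) => (lt_of_le_of_lt hxy h : x < χ ω)
  have hbetween : ∀ x y, x ≤ y → MeasurableSet {ω | x < χ ω ∧ χ ω ≤ y} := fun x y _ =>
    (measurableSet_lt measurable_const hχm).inter (measurableSet_le hχm measurable_const)
  refine ⟨?_, fun x => measureReal_le_one, hanti, ?_, ?_, ?_, ?_, ?_, ?_⟩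
  · intro x hx
    -- If L y = 0, the quotient L (2 y) / L y is 0 by convention, so slow variation forces L ≠ 0 at
    -- all large arguments; monotonicity carries positivity of the tail down to x.
    obtain ⟨y, hy1, hy2⟩ := (((hL 2 two_pos).eventually_const_lt one_half_lt_one).and
      (eventually_ge_atTop x)).exists
    have hLy : L y ≠ 0 := by
      intro h
      rw [h, div_zero] at hy1
      norm_num at hy1
    have hy0 := hx.trans_le hy2
    have h1 : μ.real {ω | y < χ ω} ≠ 0 := by
      rw [htail y hy0]
      exact div_ne_zero hLy (Real.rpow_pos_of_pos hy0 α).ne'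
    exact (measureReal_nonneg.lt_of_ne' h1).trans_le (hanti hy2)
  · intro c hc
    have h1 := (hL c hc).mul_const (c ^ (-α))
    rw [one_mul] at h1
    refine h1.congr' ?_
    filter_upwards [eventually_gt_atTop (0 : ℝ)] with x hx
    rw [htail x hx, htail (c * x) (by positivity), Real.mul_rpow hc.le hx.le, Real.rpow_neg hc.le]
    have h2 := (Real.rpow_pos_of_pos hx α).ne'
    have h3 := (Real.rpow_pos_of_pos hc α).ne'
    by_cases h4 : L x = 0
    · simp [h4]
    · field_simp
  · intro x _
    exact integral_nonneg (trunc_nonneg hχ x)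
  · intro x hx
    have := integral_mono (integrable_trunc (μ := μ) hχm hχ hx.le) (integrable_const x) (trunc_le hx.le)
    simpa using this
  · intro x y hx hxy
    exact integral_mono (integrable_trunc hχm hχ hx.le) (integrable_trunc hχm hχ (hx.le.trans hxy))
      (trunc_mono hχ hxy)
  · intro x y hx hxy
    have hix := integrable_trunc (μ := μ) hχm hχ hx.le
    have hiy := integrable_trunc (μ := μ) hχm hχ (hx.le.trans hxy)
    rw [← measureReal_between hχm hxy, ← integral_sub hiy hix, mul_comm, ← smul_eq_mul,
      ← integral_indicator_const _ (hbetween x y hxy)]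
    refine integral_mono ((integrable_const x).indicator (hbetween x y hxy)) (hiy.sub hix) ?_
    intro ω
    simp only [trunc, Set.indicator, Set.mem_ofPred_eq]
    split_ifs <;> grind
  · intro x y hx hxy
    have hix := integrable_trunc (μ := μ) hχm hχ hx.le
    have hiy := integrable_trunc (μ := μ) hχm hχ (hx.le.trans hxy)
    rw [← measureReal_between hχm hxy, ← integral_sub hiy hix, mul_comm, ← smul_eq_mul,
      ← integral_indicator_const _ (hbetween x y hxy)]
    refine integral_mono (hiy.sub hix) ((integrable_const y).indicator (hbetween x y hxy)) ?_
    intro ω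
    simp only [trunc, Set.indicator, Set.mem_ofPred_eq]
    split_ifs <;> grind

/-- Levels whose truncation keeps a definite mass are bounded below by a level of positive truncated
mean. -/
theorem exists_level_le [IsProbabilityMeasure μ] (hχm : Measurable χ) (hχ : ∀ ω, 0 ≤ χ ω) {c : ℝ}
    (hc : 0 < c) (hne : ∃ x, c ≤ μ.real {ω | 0 < χ ω ∧ χ ω ≤ x}) :
    ∃ a, 0 < a ∧ 0 < ∫ ω, trunc χ a ω ∂μ ∧
      ∀ x, c ≤ μ.real {ω | 0 < χ ω ∧ χ ω ≤ x} → a ≤ x := by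
  set s := {x | c ≤ μ.real {ω | 0 < χ ω ∧ χ ω ≤ x}} with hs
  have hpos : ∀ x ∈ s, 0 < x := by
    intro x hx
    by_contra! hx0
    have : {ω | 0 < χ ω ∧ χ ω ≤ x} = ∅ := by
      ext ω
      simp only [Set.mem_ofPred_eq, Set.mem_empty_iff_false, iff_false, not_and, not_le]
      intro h
      linarith
    rw [hs, Set.mem_ofPred_eq, this, measureReal_empty] at hx
    linarith
  have hbdd : BddBelow s := ⟨0, fun x hx => (hpos x hx).le⟩
  have hup : ∀ x y, x ∈ s → x ≤ y → y ∈ s := fun x y hx hxy =>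
    le_trans (show c ≤ _ from hx)
      (measureReal_mono fun ω (h : 0 < χ ω ∧ χ ω ≤ x) => (⟨h.1, h.2.trans hxy⟩ : 0 < χ ω ∧ χ ω ≤ y))
  have hmeas : ∀ x, MeasurableSet {ω | 0 < χ ω ∧ χ ω ≤ x} := fun x =>
    (measurableSet_lt measurable_const hχm).inter (measurableSet_le hχm measurable_const)
  set a := sInf s with ha
  -- The infimum is attained because x ↦ μ(0 < χ ≤ x) is right-continuous.
  have has : a ∈ s := by
    have h1 : ∀ n : ℕ, a + 1 / ((n : ℝ) + 1) ∈ s := by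
      intro n
      obtain ⟨x, hx, hxa⟩ := exists_lt_of_csInf_lt hne
        (lt_add_of_pos_right a (Nat.one_div_pos_of_nat (n := n) (α := ℝ)))
      exact hup x _ hx hxa.le
    have h2 : Tendsto (fun n : ℕ => μ.real {ω | 0 < χ ω ∧ χ ω ≤ a + 1 / ((n : ℝ) + 1)}) atTop
        (𝓝 (μ.real {ω | 0 < χ ω ∧ χ ω ≤ a})) := by
      have h3 : {ω | 0 < χ ω ∧ χ ω ≤ a} =
          ⋂ n : ℕ, {ω | 0 < χ ω ∧ χ ω ≤ a + 1 / ((n : ℝ) + 1)} := by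
        ext ω
        simp only [Set.mem_ofPred_eq, Set.mem_iInter]
        constructor
        · intro h n
          exact ⟨h.1, h.2.trans (le_add_of_nonneg_right (Nat.one_div_pos_of_nat).le)⟩
        · intro h
          refine ⟨(h 0).1, ?_⟩
          have h4 := (tendsto_one_div_add_atTop_nhds_zero_nat (𝕜 := ℝ)).const_add a
          rw [add_zero] at h4
          exact ge_of_tendsto' h4 fun n => (h n).2
      rw [h3]
      refine (ENNReal.tendsto_toReal (measure_ne_top μ _)).comp
        (tendsto_measure_iInter_atTop (fun n => (hmeas _).nullMeasurableSet) ?_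
          ⟨0, measure_ne_top μ _⟩)
      intro n n' hn ω hω
      exact ⟨hω.1, hω.2.trans (add_le_add_right (Nat.one_div_le_one_div hn) a)⟩
    exact ge_of_tendsto' h2 h1
  refine ⟨a, hpos a has, ?_, fun x hx => csInf_le hbdd hx⟩
  rw [integral_pos_iff_support_of_nonneg (trunc_nonneg hχ a)
    (integrable_trunc hχm hχ (hpos a has).le)]
  have h1 : 0 < μ.real {ω | 0 < χ ω ∧ χ ω ≤ a} := hc.trans_le has
  have h2 : 0 < μ {ω | 0 < χ ω ∧ χ ω ≤ a} := (ENNReal.toReal_pos_iff.1 h1).1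
  refine h2.trans_le (measure_mono fun ω hω => ?_)
  have h3 : χ ω ≤ a := hω.2
  have h4 : χ ω ≠ 0 := hω.1.ne'
  simp [trunc, h3, h4]

end Observable

/-! ### Almost sure convergence by Borel–Cantelli -/

section Truncated

variable {Ω : Type*} [MeasurableSpace Ω] {T : Ω → Ω} {μ : Measure Ω}
    {F : Type*} [NormedCommRing F] [NormedAlgebra ℂ F] [CompleteSpace F]
    {ι : F →ₗ[ℂ] (Ω →ₘ[μ] ℂ)} {χ : Ω → ℝ}

/-- Dividing the truncation by x gives a function with values in [0, 1] and norm at most K₁, so c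
can be chosen independently of x. -/
theorem ObservableSystem.exists_truncSum_deviation_le (hD : ObservableSystem T μ ι χ) {ε : ℝ}
    (hε : 0 < ε) :
    ∃ c, 0 < c ∧ ∀ x, 0 < x → ∀ n : ℕ,
      μ.real {ω | ε * (n * ∫ ω', trunc χ x ω' ∂μ) ≤
        |truncSum T χ x n ω - n * ∫ ω', trunc χ x ω' ∂μ|} ≤
      2 * Real.exp (-(c * (n * ((∫ ω', trunc χ x ω' ∂μ) / x)))) := by
  obtain ⟨K₁, hK₁, hK⟩ := hD.norm_trunc_le
  obtain ⟨c, hc, hdev⟩ := hD.spectralGapSystem.exists_deviation_le hK₁ hε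
  refine ⟨c, hc, ?_⟩
  intro x hx n
  obtain ⟨b, hb, hbK⟩ := hK x hx
  have h := hdev (fun ω => trunc χ x ω / x) ((measurable_trunc hD.measurable x).div_const x)
    (fun ω => div_nonneg (trunc_nonneg hD.nonneg x ω) hx.le)
    (fun ω => (div_le_one hx).2 (trunc_le hx.le ω)) (((x⁻¹ : ℝ) : ℂ) • b) ?_ ?_ n
  · rw [integral_div] at h
    set M := ∫ ω', trunc χ x ω' ∂μ
    have hset : {ω | ε * (n * M) ≤ |truncSum T χ x n ω - n * M|} =
        {ω | ε * (n * (M / x)) ≤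
          |birkhoffSum T (fun ω => trunc χ x ω / x) n ω - n * (M / x)|} := by
      ext ω
      have h1 : birkhoffSum T (fun ω => trunc χ x ω / x) n ω - n * (M / x) =
          (truncSum T χ x n ω - n * M) / x := by
        simp only [truncSum, birkhoffSum]
        rw [← Finset.sum_div]
        ring
      have h2 : ε * (n * (M / x)) = ε * (n * M) / x := by ring
      rw [Set.mem_ofPred_eq, Set.mem_ofPred_eq, h1, h2, abs_div, abs_of_pos hx,
        div_le_div_iff_of_pos_right hx]
    rw [hset]
    exact h
  · filter_upwards [SpectralGapSystem.coeFn_smul ι ((x⁻¹ : ℝ) : ℂ) b, hb] with ω h1 h2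
    rw [h1, h2]
    push_cast
    rw [div_eq_inv_mul]
  · rw [norm_smul, Complex.norm_real, Real.norm_eq_abs, abs_of_pos (inv_pos.2 hx),
      inv_mul_le_iff₀ hx]
    linarith

end Truncated

/-- If the normalised means are suitably large, the Birkhoff sums with varying truncation levels are
almost surely eventually close to their means. -/
theorem ObservableSystem.ae_eventually_abs_sub_le {Ω : Type*} [MeasurableSpace Ω] {T : Ω → Ω}
    {μ : Measure Ω} {F : Type*} [NormedCommRing F] [NormedAlgebra ℂ F] [CompleteSpace F]
    {ι : F →ₗ[ℂ] (Ω →ₘ[μ] ℂ)} {χ : Ω → ℝ} (hD : ObservableSystem T μ ι χ) {α : ℝ} (hα0 : 0 < α)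
    (hα1 : α < 1)
    (hR : RegularTail (fun x => μ.real {ω | x < χ ω}) (fun x => ∫ ω, trunc χ x ω ∂μ) α)
    {a : ℝ} (ha : 0 < a) (hma : 0 < ∫ ω, trunc χ a ω ∂μ) {f : ℕ → ℝ}
    (hf : ∀ᶠ n in atTop, a ≤ f n) {ψ : ℕ → ℝ} (hψ : ψ ∈ PsiClass)
    (hq : ∀ A : ℝ, 0 < A → ∀ᶠ n : ℕ in atTop,
      A * Real.log (ψ ⌊Real.log (n : ℝ)⌋₊) ≤ n * μ.real {ω | f n < χ ω})
    {η : ℝ} (hη : 0 < η) :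
    ∀ᵐ ω ∂μ, ∀ᶠ n : ℕ in atTop,
      |truncSum T χ (f n) n ω - n * ∫ ω', trunc χ (f n) ω' ∂μ| ≤
        η * (n * ∫ ω', trunc χ (f n) ω' ∂μ) := by
  have hμ := hD.spectralGapSystem.isProbabilityMeasure
  set q : ℝ → ℝ := fun x => μ.real {ω | x < χ ω} with hq_def
  set m : ℝ → ℝ := fun x => ∫ ω, trunc χ x ω ∂μ with hm_def
  obtain ⟨δ, hδη1, hδη2, hδ1, hδ⟩ : ∃ δ : ℝ, 1 - η < (1 - δ) * Real.exp (-(2 * δ)) ∧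
      (1 + δ) * Real.exp (2 * δ) < 1 + η ∧ δ < 1 ∧ 0 < δ := by
    have h1 : Tendsto (fun δ : ℝ => (1 - δ) * Real.exp (-(2 * δ))) (𝓝[>] 0) (𝓝 1) := by
      have : Continuous fun δ : ℝ => (1 - δ) * Real.exp (-(2 * δ)) := by fun_prop
      simpa using (this.tendsto 0).mono_left nhdsWithin_le_nhds
    have h2 : Tendsto (fun δ : ℝ => (1 + δ) * Real.exp (2 * δ)) (𝓝[>] 0) (𝓝 1) := by
      have : Continuous fun δ : ℝ => (1 + δ) * Real.exp (2 * δ) := by fun_prop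
      simpa using (this.tendsto 0).mono_left nhdsWithin_le_nhds
    obtain ⟨δ, h3, h4, h5⟩ := ((h1.eventually_const_lt (by linarith : 1 - η < 1)).and
      ((h2.eventually_lt_const (by linarith : 1 < 1 + η)).and
        (Ioo_mem_nhdsGT (zero_lt_one' ℝ)))).exists
    exact ⟨δ, h3, h4, h5.2, h5.1⟩
  obtain ⟨c, hc, hdev⟩ := hD.exists_truncSum_deviation_le hδ
  obtain ⟨k, hk, hkq⟩ := hR.exists_le_mean_div hα0 hα1 ha hma
  obtain ⟨H, hH, hlog⟩ := hR.exists_log_mean_div_le hα0 hα1 ha hma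
  obtain ⟨c', hc', hblock⟩ := exists_measure_block_le (μ := μ)
    (S := fun n x ω => truncSum T χ x n ω) (q := q) (m := m)
    (fun n n' x ω h => truncSum_mono_left hD.nonneg h x ω)
    (fun n x y ω h => truncSum_mono_right hD.nonneg n h ω)
    hR.antitone hk hH hδ hδ1.le hc (fun x hx => hR.pos x (ha.trans_le hx))
    (fun x hx => hR.mean_pos ha hma hx) (fun x y hx hxy => hR.mean_mono x y (ha.trans_le hx) hxy)
    hkq hlog (fun x hx n => hdev x (ha.trans_le hx) n)
  obtain ⟨r, hr⟩ := exists_nat_gt (1 / δ)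
  have hr0' : (0 : ℝ) < r := (by positivity : (0 : ℝ) < 1 / δ).trans hr
  have hr0 : 0 < r := by exact_mod_cast hr0'
  have hrδ : 1 ≤ r * δ := by
    rw [div_lt_iff₀ hδ] at hr
    exact hr.le
  -- Blocks of length 1/r ≤ δ in log n, on which ⌊log n⌋ is the constant i / r. The range bound only
  -- serves to make the block a finite set.
  set D : ℕ → Finset ℕ := fun i => (Finset.range (⌈Real.exp ((i + 1) / r)⌉₊ + 1)).filter
    fun n => 0 < n ∧ ⌊r * Real.log n⌋₊ = i with hD_def
  have hDmem : ∀ i n, n ∈ D i ↔ 0 < n ∧ ⌊r * Real.log n⌋₊ = i := by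
    intro i n
    simp only [hD_def, Finset.mem_filter, Finset.mem_range, and_iff_right_iff_imp]
    rintro ⟨hn, hi⟩
    have hn' : (0 : ℝ) < n := by exact_mod_cast hn
    have h1 : r * Real.log n < i + 1 := by
      rw [← hi]
      exact Nat.lt_floor_add_one _
    have h2 : (n : ℝ) ≤ Real.exp ((i + 1) / r) := by
      rw [← Real.log_le_iff_le_exp hn', le_div_iff₀ hr0']
      linarith
    have h3 : n ≤ ⌈Real.exp ((i + 1) / r)⌉₊ := by exact_mod_cast h2.trans (Nat.le_ceil _)
    omega
  have hDlog : ∀ i, ∀ n ∈ D i, (i : ℝ) ≤ r * Real.log n ∧ r * Real.log n < i + 1 := by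
    intro i n hn
    obtain ⟨hn0, hi⟩ := (hDmem i n).1 hn
    have h1 : 0 ≤ r * Real.log n := by
      have := Real.log_natCast_nonneg n
      positivity
    rw [← hi]
    exact ⟨Nat.floor_le h1, Nat.lt_floor_add_one _⟩
  have hDratio : ∀ i, ∀ n ∈ D i, ∀ n' ∈ D i, (n' : ℝ) ≤ Real.exp δ * n := by
    intro i n hn n' hn'
    have hn0 : (0 : ℝ) < n := by exact_mod_cast ((hDmem i n).1 hn).1
    have hn0' : (0 : ℝ) < n' := by exact_mod_cast ((hDmem i n').1 hn').1
    have h1 := (hDlog i n hn).1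
    have h2 := (hDlog i n' hn').2
    have h3 : Real.log n' ≤ δ + Real.log n := by
      have : r * Real.log n' ≤ r * (δ + Real.log n) := by linarith
      exact le_of_mul_le_mul_left this hr0'
    rw [← Real.exp_le_exp, Real.exp_add, Real.exp_log hn0, Real.exp_log hn0'] at h3
    exact h3
  have hDfloor : ∀ i, ∀ n ∈ D i, ⌊Real.log (n : ℝ)⌋₊ = i / r := by
    intro i n hn
    rw [← ((hDmem i n).1 hn).2, ← Nat.floor_div_natCast, mul_div_cancel_left₀ _ hr0'.ne']
  have htrans : ∀ P : ℕ → Prop, (∀ᶠ n in atTop, P n) → ∀ᶠ i in atTop, ∀ n ∈ D i, P n := by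
    intro P hP
    obtain ⟨n₀, hn₀⟩ := eventually_atTop.1 hP
    filter_upwards [(tendsto_natCast_atTop_atTop (R := ℝ)).eventually_ge_atTop
      (r * Real.log (n₀ + 1))] with i hi n hn
    apply hn₀
    have hn0 : (0 : ℝ) < n := by exact_mod_cast ((hDmem i n).1 hn).1
    have h1 := le_of_mul_le_mul_left (hi.trans (hDlog i n hn).1) hr0'
    rw [Real.log_le_log_iff (by positivity) hn0] at h1
    have h2 : n₀ + 1 ≤ n := by exact_mod_cast h1
    omega
  have hψsum : Summable fun i : ℕ => 1 / ψ (i / r) :=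
    summable_comp_div hψ.2 (fun n => (one_div_pos.2 (hψ.1 n)).le) hr0
  have hψ2 : ∀ᶠ i in atTop, 1 / ψ (i / r) ≤ 1 / 2 :=
    hψsum.tendsto_atTop_zero.eventually_le_const (by norm_num)
  set bad : ℕ → Set Ω := fun i => ⋃ n ∈ D i,
    {ω | ¬((1 - δ) * Real.exp (-(2 * δ)) * (n * m (f n)) ≤ truncSum T χ (f n) n ω ∧
      truncSum T χ (f n) n ω ≤ (1 + δ) * Real.exp (2 * δ) * (n * m (f n)))} with hbad
  -- With Y = log ψ(i / r) / c', the block bound 8 exp(-c' Y) is exactly 8 / ψ(i / r).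
  have hbound : ∀ᶠ i in atTop, μ.real (bad i) ≤ 8 * (1 / ψ (i / r)) := by
    filter_upwards [htrans _ hf, htrans _ (hq (1 / c') (by positivity)), hψ2] with i h1 h2 h3
    have hexp : Real.exp (-(c' * (1 / c' * Real.log (ψ (i / r))))) = 1 / ψ (i / r) := by
      rw [← mul_assoc, mul_one_div_cancel hc'.ne', one_mul, Real.exp_neg,
        Real.exp_log (hψ.1 _), one_div]
    have h4 := hblock (D i) f (1 / c' * Real.log (ψ (i / r))) (hDratio i) h1
      (fun n hn => by
        have := h2 n hn
        rwa [hDfloor i n hn] at this) (by rw [hexp]; exact h3)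
    rw [hexp] at h4
    exact h4
  obtain ⟨i₀, hi₀⟩ := eventually_atTop.1 hbound
  have hsummable : Summable fun i => μ.real (bad (i + i₀)) :=
    Summable.of_nonneg_of_le (fun _ => measureReal_nonneg)
      (fun i => hi₀ (i + i₀) (Nat.le_add_left _ _))
      ((summable_nat_add_iff i₀).2 (hψsum.mul_left 8))
  have hBC := ae_eventually_notMem (μ := μ) (s := fun i => bad (i + i₀)) (by
    have h1 : ∀ i, μ (bad (i + i₀)) = ENNReal.ofReal (μ.real (bad (i + i₀))) := fun i =>
      (ofReal_measureReal (measure_ne_top μ _)).symm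
    simp only [h1]
    exact hsummable.tsum_ofReal_ne_top)
  filter_upwards [hBC] with ω hω
  have hω' : ∀ᶠ i in atTop, ω ∉ bad i := by
    filter_upwards [(tendsto_sub_atTop_nat i₀).eventually hω, eventually_ge_atTop i₀] with i h1 h2
    rwa [Nat.sub_add_cancel h2] at h1
  have hfloor : Tendsto (fun n : ℕ => ⌊r * Real.log (n : ℝ)⌋₊) atTop atTop :=
    tendsto_nat_floor_atTop.comp
      ((Real.tendsto_log_atTop.comp tendsto_natCast_atTop_atTop).const_mul_atTop hr0')
  filter_upwards [hfloor.eventually hω', hf, eventually_gt_atTop 0] with n h1 h2 h3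
  have hmem : n ∈ D ⌊r * Real.log (n : ℝ)⌋₊ := (hDmem _ _).2 ⟨h3, rfl⟩
  simp only [hbad, Set.mem_iUnion, not_exists] at h1
  obtain ⟨h4, h5⟩ := not_not.1 (h1 n hmem)
  have hm0 : 0 ≤ n * m (f n) := mul_nonneg (Nat.cast_nonneg n) (hR.mean_pos ha hma h2).le
  have h6 := mul_le_mul_of_nonneg_right hδη1.le hm0
  have h7 := mul_le_mul_of_nonneg_right hδη2.le hm0
  rw [abs_le]
  constructor <;> linarith

theorem theorem2p4 {Ω : Type*} [MeasurableSpace Ω] (T : Ω → Ω) (μ : Measure Ω)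
    {F : Type*} [NormedCommRing F] [NormedAlgebra ℂ F] [CompleteSpace F]
    (ι : F →ₗ[ℂ] (Ω →ₘ[μ] ℂ)) (χ : Ω → ℝ) (hD : ObservableSystem T μ ι χ)
    (α : ℝ) (hα0 : 0 < α) (hα1 : α < 1) (L : ℝ → ℝ) (hL : SlowlyVarying L)
    (htail : ∀ x : ℝ, 0 < x → μ.real {ω | x < χ ω} = L x / x ^ α)
    (f : ℕ → ℝ) (hfpos : ∀ n, 0 < f n)
    (hf : ∃ c : ℝ, 0 < c ∧ ∀ᶠ n : ℕ in atTop, c ≤ μ.real {ω | 0 < χ ω ∧ χ ω ≤ f n})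
    (hcond : ∃ ψ ∈ PsiClass,
      (fun n : ℕ => f n ^ α / L (f n)) =o[atTop]
        fun n : ℕ => (n : ℝ) / Real.log (ψ ⌊Real.log (n : ℝ)⌋₊)) :
    (∀ᵐ ω ∂μ, Tendsto
      (fun n : ℕ => truncSum T χ (f n) n ω / ∫ ω', truncSum T χ (f n) n ω' ∂μ) atTop (𝓝 1)) ∧
    (Tendsto f atTop atTop →
      Tendsto (fun n : ℕ => (∫ ω', truncSum T χ (f n) n ω' ∂μ) /
        (α / (1 - α) * n * f n ^ (1 - α) * L (f n))) atTop (𝓝 1) ∧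
      ∀ᵐ ω ∂μ, Tendsto
        (fun n : ℕ => truncSum T χ (f n) n ω /
          (α / (1 - α) * n * f n ^ (1 - α) * L (f n))) atTop (𝓝 1)) := by
  have hμ := hD.spectralGapSystem.isProbabilityMeasure
  have hR := regularTail (μ := μ) hD.measurable hD.nonneg hL htail
  have hint : ∀ n, ∫ ω', truncSum T χ (f n) n ω' ∂μ = n * ∫ ω', trunc χ (f n) ω' ∂μ := fun n =>
    integral_truncSum hD.spectralGapSystem.measurePreserving hD.measurable hD.nonneg (hfpos n).le n
  obtain ⟨c, hc, hfc⟩ := hf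
  obtain ⟨a, ha, hma, hle⟩ := exists_level_le hD.measurable hD.nonneg hc
    (hfc.exists.imp' f fun _ h => h)
  have hfa : ∀ᶠ n in atTop, a ≤ f n := hfc.mono fun n hn => hle _ hn
  obtain ⟨ψ, hψ, hlittle⟩ := hcond
  have hqinv : ∀ n, f n ^ α / L (f n) = (μ.real {ω | f n < χ ω})⁻¹ := fun n => by
    rw [htail _ (hfpos n), inv_div]
  have hqpos : ∀ n, 0 < μ.real {ω | f n < χ ω} := fun n => hR.pos _ (hfpos n)
  -- Summability sends ψ to infinity, so the logarithm is eventually positive and the little-o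
  -- condition can be cleared of denominators.
  have hψ1 : ∀ᶠ n : ℕ in atTop, 1 < ψ ⌊Real.log (n : ℝ)⌋₊ := by
    have h1 : ∀ᶠ k in atTop, 1 < ψ k := by
      filter_upwards [hψ.2.tendsto_atTop_zero.eventually_lt_const one_pos] with k hk
      rwa [div_lt_one (hψ.1 k)] at hk
    exact (tendsto_nat_floor_atTop.comp
      (Real.tendsto_log_atTop.comp tendsto_natCast_atTop_atTop)).eventually h1
  have hq : ∀ A : ℝ, 0 < A → ∀ᶠ n : ℕ in atTop,
      A * Real.log (ψ ⌊Real.log (n : ℝ)⌋₊) ≤ n * μ.real {ω | f n < χ ω} := by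
    intro A hA
    filter_upwards [hlittle.bound (one_div_pos.2 hA), hψ1] with n h1 h2
    have hlogψ := Real.log_pos h2
    rw [hqinv, Real.norm_of_nonneg (inv_pos.2 (hqpos n)).le,
      Real.norm_of_nonneg (by positivity), div_mul_div_comm, one_mul,
      inv_le_iff_one_le_mul₀ (hqpos n), div_mul_eq_mul_div, le_div_iff₀ (by positivity)] at h1
    linarith
  have hmain : ∀ᵐ ω ∂μ, Tendsto
      (fun n : ℕ => truncSum T χ (f n) n ω / ∫ ω', truncSum T χ (f n) n ω' ∂μ) atTop (𝓝 1) := by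
    -- Countably many tolerances suffice, so the exceptional null sets can be united.
    have h1 : ∀ j : ℕ, ∀ᵐ ω ∂μ, ∀ᶠ n : ℕ in atTop,
        |truncSum T χ (f n) n ω - n * ∫ ω', trunc χ (f n) ω' ∂μ| ≤
          (1 / ((j : ℝ) + 1)) * (n * ∫ ω', trunc χ (f n) ω' ∂μ) := fun j =>
      hD.ae_eventually_abs_sub_le hα0 hα1 hR ha hma hfa hψ hq Nat.one_div_pos_of_nat
    filter_upwards [ae_all_iff.2 h1] with ω hω
    rw [Metric.tendsto_atTop']
    intro ε hε
    obtain ⟨j, hj⟩ := exists_nat_one_div_lt hε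
    obtain ⟨N, hN⟩ := eventually_atTop.1 (((hω j).and hfa).and (eventually_gt_atTop 0))
    refine ⟨N, fun n hn => ?_⟩
    obtain ⟨⟨h2, h3⟩, h4⟩ := hN n hn.le
    have h5 : 0 < n * ∫ ω', trunc χ (f n) ω' ∂μ :=
      mul_pos (by exact_mod_cast h4) (hR.mean_pos ha hma h3)
    rw [hint, Real.dist_eq, div_sub_one h5.ne', abs_div, abs_of_pos h5, div_lt_iff₀ h5]
    exact h2.trans_lt (mul_lt_mul_of_pos_right hj h5)
  refine ⟨hmain, fun hftop => ?_⟩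
  have hαα : 0 < α / (1 - α) := div_pos hα0 (by linarith)
  have hmean : Tendsto (fun n : ℕ => (∫ ω', truncSum T χ (f n) n ω' ∂μ) /
      (α / (1 - α) * n * f n ^ (1 - α) * L (f n))) atTop (𝓝 1) := by
    have h1 := ((hR.tendsto_mean_div hα0 hα1).comp hftop).div_const (α / (1 - α))
    rw [div_self hαα.ne'] at h1
    refine h1.congr' ?_
    filter_upwards [eventually_gt_atTop 0] with n hn
    have hn' : (n : ℝ) ≠ 0 := by exact_mod_cast hn.ne'
    -- Since f^(1-α) L(f) = f · q(f), the first asymptotic is Karamata's theorem along f n.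
    have h2 : α / (1 - α) * n * f n ^ (1 - α) * L (f n) =
        n * (f n * μ.real {ω | f n < χ ω} * (α / (1 - α))) := by
      rw [htail _ (hfpos n), Real.rpow_sub (hfpos n), Real.rpow_one]
      ring
    rw [hint, h2, mul_div_mul_left _ _ hn', Function.comp_apply, div_div]
  refine ⟨hmean, ?_⟩
  filter_upwards [hmain] with ω hω
  have h1 := hω.mul hmean
  rw [one_mul] at h1
  refine h1.congr' ?_
  filter_upwards [hfa, eventually_gt_atTop 0] with n h2 h3
  apply div_mul_div_cancel₀
  rw [hint]
  exact (mul_pos (by exact_mod_cast h3) (hR.mean_pos ha hma h2)).ne'
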